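/- Let $n\ge 1$ and $N=\binom{n+3}{3}-1$. For an $n$-dimensional Gaussian with mean $\mu$ and symmetric covariance matrix $\sigma$ (entries in $\mathbb{C}$), the moments $m_a$, $a\in\mathbb{N}^n$, are defined by $$\sum_{a}\frac{m_a}{a_1!\cdots a_n!}\,t^a=\exp\Bigl(\sum_i \mu_i t_i+\tfrac12\sum_{i,j}\sigma_{ij}t_it_j\Bigr),$$ and the moments of a mixture of $k$ Gaussians with weights $\lambda_1+\cdots+\lambda_k=1$ are the corresponding $\lambda$-weighted sums of moments. Let $\mathrm{Sec}_k(\mathcal{G}_{n,3})\subseteq\mathbb{P}^N$ be the Zariski closure of the set of points $(m_a)_{|a|\le 3}$ given by all complex parameters $(\lambda_\ell,\mu_\ell,\sigma_\ell)_{\ell=1}^k$; for $k=1$ this is the Gaussian moment variety $\mathcal{G}_{n,3}$, of dimension $n(n+3)/2$. Call $\mathcal{G}_{n,3}$ $k$-defective if $$\dim \mathrm{Sec}_k(\mathcal{G}_{n,3})<\min\Bigl\{N,\ k\,\tfrac{n(n+3)}2+k-1\Bigr\}.$$ **Theorem 3.2.** 1. For every $k\ge 2$ with $\mathrm{Sec}_k(\mathcal{G}_{n,3})\ne\mathbb{P}^N$,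 the variety $\mathcal{G}_{n,3}$ is $k$-defective. 2. For $k=2$ one has $n(n+3)+1-\dim \mathrm{Sec}_2(\mathcal{G}_{n,3})=2$. 3. Let $n\ge 3$. For a general point of $\mathrm{Sec}_2(\mathcal{G}_{n,3})$ (every point of some Zariski open dense subset) with affine coordinates $m=(m_a)_{|a|\le3}$, $m_0=1$, and for all complex numbers $\mu_{11}\ne\mu_{21}$, there is at most one choice of parameters $(\lambda_\ell,\mu_\ell,\sigma_\ell)_{\ell=1,2}$ of a mixture of two Gaussians that has the moments $m$ and whose two means have first coordinates $\mu_{11}$ and $\mu_{21}$, respectively; if moreover $\mu_{11}$ and $\mu_{21}$ both differ from the first moment $m_{10\cdots0}$, then there is exactly one. -/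

import Mathlib

open scoped LinearAlgebra.Projectivization Nat

noncomputable section

/-! ### Projective varieties over `ℂ`, with a finite set `ι` of homogeneous coordinates -/

/-- The forms (homogeneous polynomials) that vanish on a set `X` of points of projective space.
For a form, vanishing at a point does not depend on the representative vector. -/
def vanishingForms {ι : Type*} (X : Set (ℙ ℂ (ι → ℂ))) : Set (MvPolynomial ι ℂ) :=
  {p | (∃ e : ℕ, p.IsHomogeneous e) ∧ ∀ x ∈ X, MvPolynomial.eval x.rep p = 0}

/-- The Zariski closure of a set of points of projective space: the common zeros of all forms that
vanish on the set. -/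
def projClosure {ι : Type*} (X : Set (ℙ ℂ (ι → ℂ))) : Set (ℙ ℂ (ι → ℂ)) :=
  {x | ∀ p ∈ vanishingForms X, MvPolynomial.eval x.rep p = 0}

/-- The homogeneous coordinate ring of the closure of `X`: polynomials modulo the homogeneous ideal
generated by the forms that vanish on `X`. -/
abbrev HomogeneousCoordinateRing {ι : Type*} (X : Set (ℙ ℂ (ι → ℂ))) : Type _ :=
  MvPolynomial ι ℂ ⧸ Ideal.span (vanishingForms X)

/-- The dimension of a nonempty projective variety: one less than the maximal number of
algebraically independent elements of its homogeneous coordinate ring (a finite number, as there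
are finitely many coordinates). -/
def projDim {ι : Type*} (X : Set (ℙ ℂ (ι → ℂ))) : ℕ :=
  Cardinal.toNat (Algebra.trdeg ℂ (HomogeneousCoordinateRing X)) - 1

/-! ### Moments of Gaussians -/

/-- The polynomial `∑ i, μ i * t i + 1/2 * ∑ i j, σ i j * t i * t j` in the unknowns `t`, whose
exponential is the moment generating function of the Gaussian with mean `μ` and covariance `σ`. -/
def gaussianExponent {n : ℕ} (μ : Fin n → ℂ) (σ : Matrix (Fin n) (Fin n) ℂ) :
    MvPolynomial (Fin n) ℂ :=
  ∑ i, MvPolynomial.C (μ i) * MvPolynomial.X i +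
    MvPolynomial.C (1 / 2) *
      ∑ i, ∑ j, MvPolynomial.C (σ i j) * MvPolynomial.X i * MvPolynomial.X j

/-- The moment `m_a` of the Gaussian with mean `μ` and covariance `σ`, for `a = (a₁, …, aₙ)`:
it is `a₁! ⋯ aₙ!` times the coefficient of `t ^ a` in the formal power series `exp P`, where
`P = gaussianExponent μ σ`. As `P` has no constant term, the coefficient of `t ^ a` in `P ^ r` is
zero for `r > |a|`, so that the exponential series may be stopped at `r = |a|`. -/
def gaussianMoment {n : ℕ} (μ : Fin n → ℂ) (σ : Matrix (Fin n) (Fin n) ℂ) (a : Fin n →₀ ℕ) : ℂ :=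
  (∏ i, ((a i)! : ℂ)) *
    MvPolynomial.coeff a
      (∑ r ∈ Finset.range (a.degree + 1),
        MvPolynomial.C (1 / (r ! : ℂ)) * gaussianExponent μ σ ^ r)

/-- The homogeneous coordinates of the ambient projective space: exponents `a` with `|a| ≤ d`. -/
abbrev MomentIndex (n d : ℕ) : Type := {a : Fin n →₀ ℕ // a.degree ≤ d}

/-- The index of the moment `m_0` of order zero. -/
def MomentIndex.zero (n d : ℕ) : MomentIndex n d := ⟨0, by simp⟩

/-- The parameters of a mixture of `k` Gaussians in dimension `n`, over the complex numbers:
mixture weights with sum one, means, and symmetric covariance matrices. -/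
@[ext]
structure MixtureParam (n k : ℕ) where
  weight : Fin k → ℂ
  mean : Fin k → Fin n → ℂ
  cov : Fin k → Matrix (Fin n) (Fin n) ℂ
  sum_weight : ∑ l, weight l = 1
  cov_symm : ∀ l, (cov l).IsSymm

/-- The vector of all moments of order at most `d` of a mixture. -/
def MixtureParam.moments {n k : ℕ} (θ : MixtureParam n k) (d : ℕ) : MomentIndex n d → ℂ :=
  fun a => ∑ l, θ.weight l * gaussianMoment (θ.mean l) (θ.cov l) a.1

theorem MixtureParam.moments_zero {n k : ℕ} (θ : MixtureParam n k) (d : ℕ) :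
    θ.moments d (MomentIndex.zero n d) = 1 := by
  simp [MixtureParam.moments, MomentIndex.zero, gaussianMoment, θ.sum_weight]

theorem MixtureParam.moments_ne_zero {n k : ℕ} (θ : MixtureParam n k) (d : ℕ) :
    θ.moments d ≠ 0 := fun h => by
  simpa [h] using θ.moments_zero d

/-- The point of projective space whose coordinates are the moments of a mixture. -/
def MixtureParam.point {n k : ℕ} (θ : MixtureParam n k) (d : ℕ) :
    ℙ ℂ (MomentIndex n d → ℂ) :=
  Projectivization.mk ℂ (θ.moments d) (θ.moments_ne_zero d)

/-- The `k`-th secant variety `Sec_k (𝒢_{n,d})` of the Gaussian moment variety `𝒢_{n,d}`: the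
projective closure of the image of the map that sends the parameters of a mixture of `k` Gaussians
to its moments of order at most `d`. For `k = 1` this is `𝒢_{n,d}` itself. -/
def gaussianSecant (n d k : ℕ) : Set (ℙ ℂ (MomentIndex n d → ℂ)) :=
  projClosure (Set.range fun θ : MixtureParam n k => θ.point d)

/-- The dimension `N = binom (n + d) d - 1` of the ambient projective space. -/
def ambientDim (n d : ℕ) : ℕ := (n + d).choose d - 1

/-- The expected dimension `min {N, k * n(n+3)/2 + k - 1}` of `Sec_k (𝒢_{n,d})`, for `d ≥ 2` and
`k ≥ 1`. Here `n(n+3)/2` is the dimension of `𝒢_{n,d}`. -/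
def expectedDim (n d k : ℕ) : ℕ := min (ambientDim n d) (k * (n * (n + 3) / 2) + k - 1)

/-- `𝒢_{n,d}` is `k`-defective: `Sec_k (𝒢_{n,d})` has less than the expected dimension. -/
def IsDefective (n d k : ℕ) : Prop := projDim (gaussianSecant n d k) < expectedDim n d k

end

/-!
The moments of order at most three of a distribution with `m_0 = 1` are polynomials in its mean,
its covariance and its third cumulant, and conversely. A Gaussian has third cumulant zero
(`gaussianMoment_eq`). For a mixture of two Gaussians with weights `w` and `1 - w`, the third
cumulant is, as a cubic form, the product of the linear form `δ`, the difference of the means, and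
a quadratic form that is `w * (1 - w)` times the difference of the covariances plus a multiple of
`δ ^ 2` (`mixture_two_eq_cumulantMoments`). Conversely, every mean, covariance and reducible cubic
`L * Q` comes from a mixture of two Gaussians, for any given weights other than `0` and `1`
(`cumulantMoments_eq_mixture_two`). Thus the second secant variety is the closure of the set of
moment vectors whose third cumulant has a linear factor.

*Dimension.* A general reducible cubic is a product `L * Q` in which `L` is normalized to have the
coefficient `1` at a chosen variable `x`. With a scaling factor, the mean and the covariance this
makes `n * (n + 3)` parameters for the cone over the second secant variety. Each coefficient of `L`
is a root of a cubic polynomial whose coefficients are entries of the third cumulant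
(`symProd_cubic_relation`), and `Q` is a rational function of `L` and the third cumulant. Therefore
the polynomial ring of the parameters is algebraic over the homogeneous coordinate ring, and
`n * (n + 3)` is the transcendence degree of the latter (`CubicVar.projDim_gaussianSecant_two`).

*Defectivity.* As the weights of a mixture of two Gaussians can be prescribed, mixtures whose first
two weights are equal are dense in the `k`-th secant variety (`exists_equal_weights`). So one
parameter is redundant. If the secant variety does not fill the ambient space, its dimension is
also less than that of the latter (`trdeg_range_lt`).

*Identifiability.* The cubic equation for the coefficients of `L` becomes monic once the third
cumulant at `(x, x, x)` is inverted. By lying over, every point of the closure at which this entry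
is not zero has a third cumulant with a linear factor, without passing to a smaller open set
(`exists_algHom_comp_eq`, `CubicVar.exists_eq_cumulantMoments`). The linear factor is unique up to
scaling unless a certain minor formed from the cubic and its Hessian determinant vanishes, since
this minor is a multiple of a `3 × 3` subdeterminant of `Q` (`hessianMinor_symProd`,
`linearFactor_unique`). The first coordinates `a` and `b` of the means and the first moment
determine the weights, and `a - b` is the coefficient that fixes the scaling of the linear factor,
which gives the means and then the covariances.
-/

/-! ### Moments and cumulants of order at most three -/

namespace MomentIndex

variable {n : ℕ}

/-- The index of the first moment `m_i`. -/
noncomputable def one (i : Fin n) : MomentIndex n 3 := ⟨Finsupp.single i 1, by simp⟩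

/-- The index of the second moment `m_ij`. -/
noncomputable def two (i j : Fin n) : MomentIndex n 3 :=
  ⟨Finsupp.single i 1 + Finsupp.single j 1, by simp only [map_add, Finsupp.degree_single]; norm_num⟩

/-- The index of the third moment `m_ijk`. -/
noncomputable def three (i j k : Fin n) : MomentIndex n 3 :=
  ⟨Finsupp.single i 1 + Finsupp.single j 1 + Finsupp.single k 1, by
    simp only [map_add, Finsupp.degree_single]; norm_num⟩

/-- The multi-index `a`, written as a list in which `i` occurs `a i` times. -/
noncomputable def toList {d : ℕ} (a : MomentIndex n d) : List (Fin n) :=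
  (Finsupp.toMultiset a.1).toList

theorem toList_perm_of_eq {d : ℕ} (a : MomentIndex n d) (l : List (Fin n))
    (h : Finsupp.toMultiset a.1 = l) : a.toList.Perm l := by
  rw [← Multiset.coe_eq_coe, toList, Multiset.coe_toList, h]

theorem toList_zero (d : ℕ) : (zero n d).toList = [] := by
  simpa using toList_perm_of_eq (zero n d) [] (by simp [zero])

theorem toList_one (i : Fin n) : (one i).toList = [i] := by
  simpa using toList_perm_of_eq (one i) [i] (by simp [one, Finsupp.toMultiset_single])

theorem toList_two (i j : Fin n) : (two i j).toList.Perm [i, j] :=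
  toList_perm_of_eq (two i j) [i, j] (by
    simp only [two, map_add, Finsupp.toMultiset_single, one_smul]; rfl)

theorem toList_three (i j k : Fin n) : (three i j k).toList.Perm [i, j, k] :=
  toList_perm_of_eq (three i j k) [i, j, k] (by
    simp only [three, map_add, Finsupp.toMultiset_single, one_smul]; rfl)

theorem length_toList {d : ℕ} (a : MomentIndex n d) : a.toList.length = a.1.degree := by
  simp [toList, Finsupp.card_toMultiset, Finsupp.degree_apply, Finsupp.sum]

theorem eq_of_toList {d : ℕ} (a : MomentIndex n d) :
    a.1 = Multiset.toFinsupp (a.toList : Multiset (Fin n)) := by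
  simp [toList]

theorem cases_three (a : MomentIndex n 3) :
    a = zero n 3 ∨ (∃ i, a = one i) ∨ (∃ i j, a = two i j) ∨ ∃ i j k, a = three i j k := by
  have hlen : a.toList.length ≤ 3 := a.length_toList.trans_le a.2
  have h := a.eq_of_toList
  revert hlen h
  rcases a.toList with _ | ⟨i, _ | ⟨j, _ | ⟨k, _ | ⟨l, t⟩⟩⟩⟩ <;> intro hlen h
  · exact Or.inl (Subtype.ext (by rw [h]; simp [zero]))
  · exact Or.inr (Or.inl ⟨i, Subtype.ext (by rw [h]; simp [one, Multiset.toFinsupp_singleton])⟩)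
  · refine Or.inr (Or.inr (Or.inl ⟨i, j, Subtype.ext ?_⟩))
    rw [h, show (([i, j] : List (Fin n)) : Multiset (Fin n)) = {i} + {j} from rfl]
    simp only [two, map_add, Multiset.toFinsupp_singleton]
  · refine Or.inr (Or.inr (Or.inr ⟨i, j, k, Subtype.ext ?_⟩))
    rw [h, show (([i, j, k] : List (Fin n)) : Multiset (Fin n)) = {i} + {j} + {k} from rfl]
    simp only [three, map_add, Multiset.toFinsupp_singleton]
  · simp only [List.length_cons] at hlen; omega

/-- Two functions on the moment indices agree if they agree on all `m_0`, `m_i`, `m_ij`, `m_ijk`. -/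
theorem funext_three {α : Type*} {f g : MomentIndex n 3 → α}
    (h₀ : f (zero n 3) = g (zero n 3)) (h₁ : ∀ i, f (one i) = g (one i))
    (h₂ : ∀ i j, f (two i j) = g (two i j)) (h₃ : ∀ i j k, f (three i j k) = g (three i j k)) :
    f = g := by
  funext a
  rcases a.cases_three with rfl | ⟨i, rfl⟩ | ⟨i, j, rfl⟩ | ⟨i, j, k, rfl⟩
  exacts [h₀, h₁ i, h₂ i j, h₃ i j k]

end MomentIndex

section MomentVector

variable {n : ℕ} {R S : Type*} [CommRing R] [CommRing S]

/-- The vector of moments of order at most three with `m_0 = 1` and with prescribed tensors of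
first, second and third moments. It is meant for symmetric tensors, for which the order of the
list `a.toList` does not matter. -/
noncomputable def momentVector (M₁ : Fin n → R) (M₂ : Fin n → Fin n → R)
    (M₃ : Fin n → Fin n → Fin n → R) (a : MomentIndex n 3) : R :=
  match a.toList with
  | [] => 1
  | [i] => M₁ i
  | [i, j] => M₂ i j
  | i :: j :: k :: _ => M₃ i j k

/-- Symmetry of a tensor of order three in its three indices. -/
def IsSymmTensor (K : Fin n → Fin n → Fin n → R) : Prop :=
  (∀ i j k, K i j k = K j i k) ∧ ∀ i j k, K i j k = K i k j

variable (M₁ : Fin n → R) (M₂ : Fin n → Fin n → R) (M₃ : Fin n → Fin n → Fin n → R)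

@[simp] theorem momentVector_zero : momentVector M₁ M₂ M₃ (MomentIndex.zero n 3) = 1 := by
  simp [momentVector, MomentIndex.toList_zero]

@[simp] theorem momentVector_one (i : Fin n) :
    momentVector M₁ M₂ M₃ (MomentIndex.one i) = M₁ i := by
  simp [momentVector, MomentIndex.toList_one]

variable {M₂ M₃}

theorem momentVector_two (h : ∀ i j, M₂ i j = M₂ j i) (i j : Fin n) :
    momentVector M₁ M₂ M₃ (MomentIndex.two i j) = M₂ i j := by
  have := List.mem_permutations.2 (MomentIndex.toList_two i j)
  simp [List.permutations, List.permutationsAux, List.permutationsAux.rec,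
    List.permutationsAux2] at this
  rcases this with h' | h' <;> simp [momentVector, h', h i j]

theorem momentVector_three (h : IsSymmTensor M₃) (i j k : Fin n) :
    momentVector M₁ M₂ M₃ (MomentIndex.three i j k) = M₃ i j k := by
  have := List.mem_permutations.2 (MomentIndex.toList_three i j k)
  simp [List.permutations, List.permutationsAux, List.permutationsAux.rec,
    List.permutationsAux2] at this
  obtain ⟨h₁, h₂⟩ := h
  rcases this with h' | h' | h' | h' | h' | h' <;> simp only [momentVector, h']
  · grind
  · grind
  · grind
  · grind
  · grind

theorem map_momentVector (f : R →+* S) (M₁ : Fin n → R) (M₂ : Fin n → Fin n → R)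
    (M₃ : Fin n → Fin n → Fin n → R) (a : MomentIndex n 3) :
    f (momentVector M₁ M₂ M₃ a) = momentVector (fun i => f (M₁ i)) (fun i j => f (M₂ i j))
      (fun i j k => f (M₃ i j k)) a := by
  unfold momentVector
  split <;> simp

/-- The moments of order at most three of a distribution with mean `c₁`, covariance `c₂` and third
cumulant (third central moment) `c₃`. -/
noncomputable def cumulantMoments (c₁ : Fin n → R) (c₂ : Fin n → Fin n → R)
    (c₃ : Fin n → Fin n → Fin n → R) : MomentIndex n 3 → R :=
  momentVector c₁ (fun i j => c₂ i j + c₁ i * c₁ j) (fun i j k =>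
    c₃ i j k + (c₁ i * c₂ j k + c₁ j * c₂ i k + c₁ k * c₂ i j) + c₁ i * c₁ j * c₁ k)

variable {c₁ : Fin n → R} {c₂ : Fin n → Fin n → R} {c₃ : Fin n → Fin n → Fin n → R}

@[simp] theorem cumulantMoments_zero :
    cumulantMoments c₁ c₂ c₃ (MomentIndex.zero n 3) = 1 := momentVector_zero _ _ _

@[simp] theorem cumulantMoments_one (i : Fin n) :
    cumulantMoments c₁ c₂ c₃ (MomentIndex.one i) = c₁ i := momentVector_one _ _ _ i

theorem cumulantMoments_two (h₂ : ∀ i j, c₂ i j = c₂ j i) (i j : Fin n) :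
    cumulantMoments c₁ c₂ c₃ (MomentIndex.two i j) = c₂ i j + c₁ i * c₁ j :=
  momentVector_two _ (fun i j => by rw [h₂, mul_comm]) i j

theorem cumulantMoments_three (h₂ : ∀ i j, c₂ i j = c₂ j i) (h₃ : IsSymmTensor c₃)
    (i j k : Fin n) :
    cumulantMoments c₁ c₂ c₃ (MomentIndex.three i j k) =
      c₃ i j k + (c₁ i * c₂ j k + c₁ j * c₂ i k + c₁ k * c₂ i j) + c₁ i * c₁ j * c₁ k := by
  refine momentVector_three _ ⟨fun i j k => ?_, fun i j k => ?_⟩ i j k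
  · rw [h₃.1 i j k, h₂ i j]; ring
  · rw [h₃.2 i j k, h₂ j k]; ring

theorem map_cumulantMoments (f : R →+* S) (a : MomentIndex n 3) :
    f (cumulantMoments c₁ c₂ c₃ a) = cumulantMoments (fun i => f (c₁ i)) (fun i j => f (c₂ i j))
      (fun i j k => f (c₃ i j k)) a := by
  simp only [cumulantMoments, map_momentVector, map_add, map_mul]

/-- The symmetric product of a vector and a matrix: up to the factor `3`, the tensor of the cubic
form that is the product of a linear form and a quadratic form. -/
def symProd (L : Fin n → R) (Q : Fin n → Fin n → R) (i j k : Fin n) : R :=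
  L i * Q j k + L j * Q i k + L k * Q i j

theorem isSymmTensor_symProd {L : Fin n → R} {Q : Fin n → Fin n → R}
    (hQ : ∀ i j, Q i j = Q j i) : IsSymmTensor (symProd L Q) := by
  refine ⟨fun i j k => ?_, fun i j k => ?_⟩
  · simp only [symProd, hQ i j]; ring
  · simp only [symProd, hQ j k]; ring

theorem isSymmTensor_zero : IsSymmTensor (fun _ _ _ => 0 : Fin n → Fin n → Fin n → R) :=
  ⟨fun _ _ _ => rfl, fun _ _ _ => rfl⟩

end MomentVector

/-! ### Moments of Gaussians -/

section Gaussian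

variable {n : ℕ}

open MvPolynomial in
theorem factorial_mul_coeff_add_single (f : MvPolynomial (Fin n) ℂ) (a : Fin n →₀ ℕ) (i : Fin n) :
    (∏ j, (((a + Finsupp.single i 1 : Fin n →₀ ℕ) j)! : ℂ)) * coeff (a + Finsupp.single i 1) f =
      (∏ j, ((a j)! : ℂ)) * coeff a (pderiv i f) := by
  have h : ∏ j, (((a + Finsupp.single i 1 : Fin n →₀ ℕ) j)! : ℂ) =
      (∏ j, ((a j)! : ℂ)) * (a i + 1) := by
    rw [← Finset.mul_prod_erase _ _ (Finset.mem_univ i),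
      ← Finset.mul_prod_erase _ (fun j => ((a j)! : ℂ)) (Finset.mem_univ i)]
    have : ∀ j ∈ Finset.univ.erase i,
        (((a + Finsupp.single i 1 : Fin n →₀ ℕ) j)! : ℂ) = ((a j)! : ℂ) := by
      intro j hj
      rw [Finsupp.add_apply, Finsupp.single_eq_of_ne (Finset.ne_of_mem_erase hj), add_zero]
    rw [Finset.prod_congr rfl this]
    simp [Nat.factorial_succ]
    ring
  rw [h, coeff_pderiv]
  ring

open MvPolynomial in
theorem pderiv_gaussianExponent (μ : Fin n → ℂ) {σ : Matrix (Fin n) (Fin n) ℂ} (hσ : σ.IsSymm)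
    (i : Fin n) :
    pderiv i (gaussianExponent μ σ) = C (μ i) + ∑ j, C (σ i j) * X j := by
  classical
  have h2 : (C (1 / 2) : MvPolynomial (Fin n) ℂ) * 2 = 1 := by
    rw [show (2 : MvPolynomial (Fin n) ℂ) = C 2 from rfl, ← C_mul]; norm_num
  simp only [gaussianExponent, map_add, map_sum, pderiv_C_mul, pderiv_X, mul_assoc]
  congr 1
  · simp [Pi.single_apply]
  · simp only [Derivation.leibniz, pderiv_X, smul_eq_mul, Pi.single_apply, mul_add,
      Finset.sum_add_distrib, mul_ite, mul_one, mul_zero, Finset.sum_ite_eq', Finset.mem_univ,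
      Finset.sum_ite_irrel, Finset.sum_const_zero, if_true, hσ.apply i]
    rw [← mul_add, ← two_mul, ← mul_assoc, h2, one_mul]

open MvPolynomial in
theorem pderiv_pderiv_gaussianExponent (μ : Fin n → ℂ) {σ : Matrix (Fin n) (Fin n) ℂ}
    (hσ : σ.IsSymm) (i j : Fin n) :
    pderiv i (pderiv j (gaussianExponent μ σ)) = C (σ i j) := by
  classical
  simp [pderiv_gaussianExponent μ hσ, pderiv_X, Pi.single_apply, hσ.apply i j]

open MvPolynomial in
/-- The exponential series of the polynomial `P`, truncated after `r` terms. -/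
noncomputable def truncatedExp (P : MvPolynomial (Fin n) ℂ) (r : ℕ) : MvPolynomial (Fin n) ℂ :=
  ∑ s ∈ Finset.range r, C (1 / (s ! : ℂ)) * P ^ s

open MvPolynomial in
theorem pderiv_truncatedExp (P : MvPolynomial (Fin n) ℂ) (i : Fin n) (r : ℕ) :
    pderiv i (truncatedExp P (r + 1)) = pderiv i P * truncatedExp P r := by
  rw [truncatedExp, Finset.sum_range_succ', truncatedExp, Finset.mul_sum]
  simp only [map_add, map_sum, pderiv_C_mul, pow_zero, pderiv_one, mul_zero, add_zero]
  refine Finset.sum_congr rfl fun s _ => ?_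
  have : (C (1 / ((s + 1)! : ℂ)) * ((s + 1 : ℕ) : MvPolynomial (Fin n) ℂ)) = C (1 / (s ! : ℂ)) := by
    rw [← map_natCast (C : ℂ →+* MvPolynomial (Fin n) ℂ), ← C_mul]
    congr 1
    have h : (s ! : ℂ) ≠ 0 := by exact_mod_cast s.factorial_ne_zero
    have h' : (s : ℂ) + 1 ≠ 0 := by exact_mod_cast s.succ_ne_zero
    rw [Nat.factorial_succ]
    push_cast
    field_simp
  rw [pderiv_pow, ← this]
  simp only [Nat.add_sub_cancel]
  ring

open MvPolynomial in
theorem constantCoeff_truncatedExp {P : MvPolynomial (Fin n) ℂ} (hP : constantCoeff P = 0)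
    (r : ℕ) : constantCoeff (truncatedExp P (r + 1)) = 1 := by
  rw [truncatedExp, Finset.sum_range_succ']
  simp [hP]

theorem gaussianMoment_eq_constantCoeff (μ : Fin n → ℂ) (σ : Matrix (Fin n) (Fin n) ℂ)
    (a : Fin n →₀ ℕ) :
    gaussianMoment μ σ a = (∏ i, ((a i)! : ℂ)) *
      MvPolynomial.coeff a (truncatedExp (gaussianExponent μ σ) (a.degree + 1)) := rfl

open MvPolynomial in
/-- The Gaussian with mean `μ` and covariance `σ` has vanishing third cumulant. The coefficients of
the exponential series are computed as iterated derivatives at the origin. -/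
theorem gaussianMoment_eq (μ : Fin n → ℂ) {σ : Matrix (Fin n) (Fin n) ℂ} (hσ : σ.IsSymm) :
    (fun a : MomentIndex n 3 => gaussianMoment μ σ a.1) =
      cumulantMoments μ (fun i j => σ i j) (fun _ _ _ => 0) := by
  have hs : ∀ i j, σ i j = σ j i := fun i j => hσ.apply j i
  have e0 : constantCoeff (gaussianExponent μ σ) = 0 := by simp [gaussianExponent]
  have e1 : ∀ i, constantCoeff (pderiv i (gaussianExponent μ σ)) = μ i := fun i => by
    simp [pderiv_gaussianExponent μ hσ]
  set P := gaussianExponent μ σ with hP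
  refine MomentIndex.funext_three ?_ (fun i => ?_) (fun i j => ?_) (fun i j k => ?_)
  · rw [cumulantMoments_zero]; simp [gaussianMoment, MomentIndex.zero]
  · have h1 := factorial_mul_coeff_add_single (truncatedExp P 2) 0 i
    rw [zero_add] at h1
    rw [cumulantMoments_one]
    simp only [gaussianMoment_eq_constantCoeff, MomentIndex.one, Finsupp.degree_single]
    rw [h1, ← constantCoeff_eq, pderiv_truncatedExp]
    simp [e1, constantCoeff_truncatedExp e0]
  · have h2 := factorial_mul_coeff_add_single (truncatedExp P 3) (Finsupp.single i 1) j
    have h1 := factorial_mul_coeff_add_single (pderiv j (truncatedExp P 3)) 0 i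
    rw [zero_add] at h1
    rw [cumulantMoments_two hs]
    simp only [gaussianMoment_eq_constantCoeff, MomentIndex.two, Finsupp.degree_single, map_add]
    rw [h2, h1, ← constantCoeff_eq]
    simp only [pderiv_truncatedExp, pderiv_mul, hP, pderiv_pderiv_gaussianExponent μ hσ]
    simp only [← hP, map_add, map_mul, constantCoeff_C, e1, constantCoeff_truncatedExp e0]
    simp [mul_comm]
  · have h3 := factorial_mul_coeff_add_single (truncatedExp P 4)
      (Finsupp.single i 1 + Finsupp.single j 1) k
    have h2 := factorial_mul_coeff_add_single (pderiv k (truncatedExp P 4))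
      (Finsupp.single i 1) j
    have h1 := factorial_mul_coeff_add_single (pderiv j (pderiv k (truncatedExp P 4))) 0 i
    rw [zero_add] at h1
    rw [cumulantMoments_three hs isSymmTensor_zero]
    simp only [gaussianMoment_eq_constantCoeff, MomentIndex.three, Finsupp.degree_single, map_add]
    rw [h3, h2, h1, ← constantCoeff_eq]
    simp only [pderiv_truncatedExp, pderiv_mul, map_add, hP, pderiv_pderiv_gaussianExponent μ hσ,
      pderiv_C]
    simp only [← hP, map_add, map_mul, constantCoeff_C, e1, constantCoeff_truncatedExp e0]
    simp
    ring

end Gaussian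

/-! ### Zariski closures in projective space -/

section ProjClosure

variable {ι : Type*}

theorem eval_smul_of_isHomogeneous {p : MvPolynomial ι ℂ} {e : ℕ} (hp : p.IsHomogeneous e)
    (t : ℂ) (x : ι → ℂ) :
    MvPolynomial.eval (t • x) p = t ^ e * MvPolynomial.eval x p := by
  rw [MvPolynomial.eval_eq, MvPolynomial.eval_eq, Finset.mul_sum]
  refine Finset.sum_congr rfl fun d hd => ?_
  have : ∑ i ∈ d.support, d i = e := by
    have := hp (MvPolynomial.mem_support_iff.1 hd)
    simpa [Finsupp.weight_apply, Finsupp.sum] using this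
  simp only [Pi.smul_apply, smul_eq_mul, mul_pow, Finset.prod_mul_distrib,
    Finset.prod_pow_eq_pow_sum, this]
  ring

theorem eval_homogeneousComponent_eq_zero {f : MvPolynomial ι ℂ} {x : ι → ℂ}
    (h : ∀ t : ℂ, MvPolynomial.eval (t • x) f = 0) (e : ℕ) :
    MvPolynomial.eval x (MvPolynomial.homogeneousComponent e f) = 0 := by
  set N := f.totalDegree + 1 with hN
  set q : Polynomial ℂ := ∑ i ∈ Finset.range N,
    Polynomial.C (MvPolynomial.eval x (MvPolynomial.homogeneousComponent i f)) * Polynomial.X ^ i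
    with hq
  have hq0 : q = 0 := by
    refine Polynomial.funext fun t => ?_
    rw [Polynomial.eval_zero, ← h t]
    conv_rhs => rw [← MvPolynomial.sum_homogeneousComponent f]
    rw [hq, map_sum, Polynomial.eval_finsetSum]
    refine Finset.sum_congr rfl fun i _ => ?_
    rw [eval_smul_of_isHomogeneous (MvPolynomial.homogeneousComponent_isHomogeneous i f)]
    rw [Polynomial.eval_mul, Polynomial.eval_C, Polynomial.eval_pow, Polynomial.eval_X, mul_comm]
  by_cases he : e < N
  · have := congrArg (fun p => Polynomial.coeff p e) hq0
    simpa [hq, Polynomial.finsetSum_coeff, Polynomial.coeff_C_mul, Polynomial.coeff_X_pow, he]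
      using this
  · rw [MvPolynomial.homogeneousComponent_eq_zero _ _ (by omega), map_zero]

theorem subset_projClosure (X : Set (ℙ ℂ (ι → ℂ))) : X ⊆ projClosure X :=
  fun _ hx _ hp => hp.2 _ hx

theorem vanishingForms_projClosure (X : Set (ℙ ℂ (ι → ℂ))) :
    vanishingForms (projClosure X) = vanishingForms X :=
  Set.Subset.antisymm (fun _ hp => ⟨hp.1, fun x hx => hp.2 x (subset_projClosure X hx)⟩)
    (fun p hp => ⟨hp.1, fun _ hx => hx p hp⟩)

/-- Whether a form vanishes at a point does not depend on the representative vector. -/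
theorem eval_rep_eq_zero_iff {p : MvPolynomial ι ℂ} {e : ℕ} (hp : p.IsHomogeneous e)
    {x : ι → ℂ} (hx : x ≠ 0) :
    MvPolynomial.eval (Projectivization.mk ℂ x hx).rep p = 0 ↔ MvPolynomial.eval x p = 0 := by
  obtain ⟨a, ha⟩ := Projectivization.exists_smul_eq_mk_rep ℂ x hx
  rw [← ha, Units.smul_def, eval_smul_of_isHomogeneous hp]
  simp

/-- The zero locus of a form is closed. -/
theorem projClosure_zeroLocus {F : MvPolynomial ι ℂ} {e : ℕ} (hF : F.IsHomogeneous e) :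
    projClosure {x : ℙ ℂ (ι → ℂ) | MvPolynomial.eval x.rep F = 0} =
      {x | MvPolynomial.eval x.rep F = 0} :=
  Set.Subset.antisymm (fun _ hx => hx F ⟨⟨e, hF⟩, fun _ hy => hy⟩) (subset_projClosure _)

end ProjClosure

section Secant

variable {n d k : ℕ}

theorem mem_vanishingForms_gaussianSecant {p : MvPolynomial (MomentIndex n d) ℂ} :
    p ∈ vanishingForms (gaussianSecant n d k) ↔
      (∃ e, p.IsHomogeneous e) ∧
        ∀ θ : MixtureParam n k, MvPolynomial.eval (θ.moments d) p = 0 := by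
  rw [gaussianSecant, vanishingForms_projClosure]
  refine and_congr_right fun ⟨e, he⟩ => ?_
  rw [Set.forall_mem_range]
  exact forall_congr' fun θ => eval_rep_eq_zero_iff he _

/-- The homogeneous ideal of the secant variety consists of the polynomials that vanish on the
cone over the set of moment vectors. -/
theorem mem_span_vanishingForms_iff {f : MvPolynomial (MomentIndex n d) ℂ} :
    f ∈ Ideal.span (vanishingForms (gaussianSecant n d k)) ↔
      ∀ (θ : MixtureParam n k) (t : ℂ), MvPolynomial.eval (t • θ.moments d) f = 0 := by
  constructor
  · intro hf θ t
    have : Ideal.span (vanishingForms (gaussianSecant n d k)) ≤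
        RingHom.ker (MvPolynomial.eval (t • θ.moments d)) := by
      refine Ideal.span_le.2 fun p hp => ?_
      obtain ⟨⟨e, he⟩, h⟩ := mem_vanishingForms_gaussianSecant.1 hp
      rw [SetLike.mem_coe, RingHom.mem_ker, eval_smul_of_isHomogeneous he, h θ, mul_zero]
    exact this hf
  · intro h
    rw [← MvPolynomial.sum_homogeneousComponent f]
    refine Ideal.sum_mem _ fun i _ => Ideal.subset_span ?_
    exact mem_vanishingForms_gaussianSecant.2
      ⟨⟨i, MvPolynomial.homogeneousComponent_isHomogeneous i f⟩,
        fun θ => eval_homogeneousComponent_eq_zero (h θ) i⟩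

theorem eval_eq_zero_of_mem_gaussianSecant {m : MomentIndex n d → ℂ} {hm : m ≠ 0}
    (h : Projectivization.mk ℂ m hm ∈ gaussianSecant n d k)
    {f : MvPolynomial (MomentIndex n d) ℂ}
    (hf : ∀ (θ : MixtureParam n k) (t : ℂ), MvPolynomial.eval (t • θ.moments d) f = 0) :
    MvPolynomial.eval m f = 0 := by
  have : Ideal.span (vanishingForms (gaussianSecant n d k)) ≤
      RingHom.ker (MvPolynomial.eval m) := by
    refine Ideal.span_le.2 fun p hp => ?_
    obtain ⟨e, he⟩ := hp.1
    exact (eval_rep_eq_zero_iff he hm).1 (hp.2 _ h)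
  exact this (mem_span_vanishingForms_iff.2 hf)

/-- A polynomial that vanishes on a line outside one point vanishes at this point too. -/
theorem eval_eq_zero_of_punctured_line {ι : Type*} (f : MvPolynomial ι ℂ) {c : ℂ → ι → ℂ}
    (hc : Continuous c) (t₀ : ℂ)
    (h : ∀ t, t ≠ t₀ → MvPolynomial.eval (c t) f = 0) (t : ℂ) : MvPolynomial.eval (c t) f = 0 := by
  have h₁ : Continuous fun t => MvPolynomial.eval (c t) f :=
    (MvPolynomial.continuous_eval f).comp hc
  have := h₁.ext_on (dense_compl_singleton t₀) (continuous_const (y := (0 : ℂ)))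
    (fun t ht => h t ht)
  exact congrFun this t

end Secant

/-! ### Cumulants of mixtures of two Gaussians -/

section TwoGaussians

variable {n : ℕ}

/-- The third cumulant of a mixture of two Gaussians is the product of a linear form, given by the
difference of the means, and a quadratic form. -/
theorem mixture_two_eq_cumulantMoments (w : ℂ) (μ ν : Fin n → ℂ) {σ τ : Fin n → Fin n → ℂ}
    (hσ : ∀ i j, σ i j = σ j i) (hτ : ∀ i j, τ i j = τ j i) :
    w • cumulantMoments μ σ (fun _ _ _ => 0) + (1 - w) • cumulantMoments ν τ (fun _ _ _ => 0) =
      cumulantMoments (fun i => w * μ i + (1 - w) * ν i)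
        (fun i j => w * σ i j + (1 - w) * τ i j + w * (1 - w) * (μ i - ν i) * (μ j - ν j))
        (symProd (fun i => μ i - ν i) fun i j =>
          w * (1 - w) * (σ i j - τ i j + (1 - 2 * w) / 3 * ((μ i - ν i) * (μ j - ν j)))) := by
  have hC : ∀ i j, w * σ i j + (1 - w) * τ i j + w * (1 - w) * (μ i - ν i) * (μ j - ν j) =
      w * σ j i + (1 - w) * τ j i + w * (1 - w) * (μ j - ν j) * (μ i - ν i) := fun i j => by
    rw [hσ i j, hτ i j]; ring
  have hK := isSymmTensor_symProd (L := fun i => μ i - ν i) (Q := fun i j =>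
    w * (1 - w) * (σ i j - τ i j + (1 - 2 * w) / 3 * ((μ i - ν i) * (μ j - ν j))))
    (fun i j => by rw [hσ i j, hτ i j]; ring)
  refine MomentIndex.funext_three ?_ (fun i => ?_) (fun i j => ?_) (fun i j k => ?_)
  · simp
  · simp
  · simp only [Pi.add_apply, Pi.smul_apply, smul_eq_mul, cumulantMoments_two hσ,
      cumulantMoments_two hτ, cumulantMoments_two hC]
    ring
  · simp only [Pi.add_apply, Pi.smul_apply, smul_eq_mul,
      cumulantMoments_three hσ isSymmTensor_zero, cumulantMoments_three hτ isSymmTensor_zero,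
      cumulantMoments_three hC hK, symProd]
    ring

/-- Conversely, every third cumulant with a linear factor is that of a mixture of two Gaussians
whose weights are prescribed nonzero numbers. -/
theorem cumulantMoments_eq_mixture_two {w : ℂ} (h₀ : w ≠ 0) (h₁ : 1 - w ≠ 0) (m : Fin n → ℂ)
    {C : Fin n → Fin n → ℂ} (hC : ∀ i j, C i j = C j i) (L : Fin n → ℂ)
    {Q : Fin n → Fin n → ℂ} (hQ : ∀ i j, Q i j = Q j i) :
    ∃ σ τ : Fin n → Fin n → ℂ, (∀ i j, σ i j = σ j i) ∧ (∀ i j, τ i j = τ j i) ∧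
      cumulantMoments m C (symProd L Q) =
        w • cumulantMoments (fun i => m i + (1 - w) * L i) σ (fun _ _ _ => 0) +
          (1 - w) • cumulantMoments (fun i => m i - w * L i) τ (fun _ _ _ => 0) := by
  have hσ : ∀ i j,
      C i j - w * (1 - w) * (L i * L j) +
          (1 - w) * (Q i j / (w * (1 - w)) - (1 - 2 * w) / 3 * (L i * L j)) =
        C j i - w * (1 - w) * (L j * L i) +
          (1 - w) * (Q j i / (w * (1 - w)) - (1 - 2 * w) / 3 * (L j * L i)) := fun i j => by
    rw [hC i j, hQ i j]; ring
  have hτ : ∀ i j,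
      C i j - w * (1 - w) * (L i * L j) -
          w * (Q i j / (w * (1 - w)) - (1 - 2 * w) / 3 * (L i * L j)) =
        C j i - w * (1 - w) * (L j * L i) -
          w * (Q j i / (w * (1 - w)) - (1 - 2 * w) / 3 * (L j * L i)) := fun i j => by
    rw [hC i j, hQ i j]; ring
  refine ⟨_, _, hσ, hτ, ?_⟩
  rw [mixture_two_eq_cumulantMoments w _ _ hσ hτ]
  have e : ∀ i, m i + (1 - w) * L i - (m i - w * L i) = L i := fun i => by ring
  simp only [e]
  congr 1
  · funext i; ring
  · funext i j; ring
  · congr 1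
    funext i j
    field_simp
    ring

theorem cumulantMoments_injective {m m' : Fin n → ℂ} {C C' : Fin n → Fin n → ℂ}
    {K K' : Fin n → Fin n → Fin n → ℂ} (hC : ∀ i j, C i j = C j i) (hC' : ∀ i j, C' i j = C' j i)
    (hK : IsSymmTensor K) (hK' : IsSymmTensor K')
    (h : cumulantMoments m C K = cumulantMoments m' C' K') : m = m' ∧ C = C' ∧ K = K' := by
  have h₁ : m = m' := funext fun i => by simpa using congrFun h (MomentIndex.one i)
  subst h₁
  have h₂ : C = C' := funext fun i => funext fun j => by
    simpa [cumulantMoments_two hC, cumulantMoments_two hC'] using congrFun h (MomentIndex.two i j)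
  subst h₂
  refine ⟨rfl, rfl, funext fun i => funext fun j => funext fun k => ?_⟩
  simpa [cumulantMoments_three hC hK, cumulantMoments_three hC hK'] using
    congrFun h (MomentIndex.three i j k)

end TwoGaussians

/-! ### Cubic forms with a linear factor -/

section LinearFactor

variable {n : ℕ} {R : Type*} [CommRing R]

/-- The determinant of the `3 × 3` matrix with rows `(K x j p)`, `(K y j q)`, `(K z j r)`, where `j`
runs over `x, y, z`. Up to a constant, the coefficients of the Hessian determinant of the cubic form
`K` in three variables are sums of such determinants. -/
def sliceDet (K : Fin n → Fin n → Fin n → R) (x y z p q r : Fin n) : R :=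
  K x x p * (K y y q * K z z r - K y z q * K z y r) -
    K x y p * (K y x q * K z z r - K y z q * K z x r) +
    K x z p * (K y x q * K z y r - K y y q * K z x r)

/-- The determinant formed by the coefficients at `x ^ 3` and `x ^ 2 * y` of a cubic form `K` in
three variables and of its Hessian determinant, up to a constant. It is zero if `K` is a product of
three linear forms, as the Hessian determinant is then a multiple of `K`. -/
def hessianMinor (K : Fin n → Fin n → Fin n → R) (x y z : Fin n) : R :=
  K x x x * (sliceDet K x y z y x x + sliceDet K x y z x y x + sliceDet K x y z x x y) -
    3 * K x x y * sliceDet K x y z x x x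

/-- The determinant of a `3 × 3` submatrix of a matrix. -/
def subDet (Q : Fin n → Fin n → R) (x y z : Fin n) : R :=
  Q x x * (Q y y * Q z z - Q y z * Q z y) - Q x y * (Q y x * Q z z - Q y z * Q z x) +
    Q x z * (Q y x * Q z y - Q y y * Q z x)

theorem hessianMinor_symProd (L : Fin n → R) {Q : Fin n → Fin n → R} (hQ : ∀ i j, Q i j = Q j i)
    (x y z : Fin n) :
    hessianMinor (symProd L Q) x y z =
      24 * subDet Q x y z * L x ^ 3 * (L y * Q x x - L x * Q x y) := by
  simp only [hessianMinor, sliceDet, subDet, symProd, hQ y x, hQ z x, hQ z y]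
  ring

/-- A linear factor of a cubic form is unique up to scaling if `hessianMinor` does not vanish: the
quadratic cofactor is zero on the kernel of any other linear factor, so that its rank is at most
two. -/
theorem linearFactor_unique [IsDomain R] [CharZero R] {L L' : Fin n → R} {Q Q' : Fin n → Fin n → R}
    (hQ : ∀ i j, Q i j = Q j i) (hQ' : ∀ i j, Q' i j = Q' j i)
    (h : symProd L Q = symProd L' Q') (x y z : Fin n) (hx : L x = L' x)
    (hP : hessianMinor (symProd L Q) x y z ≠ 0) : L = L' := by
  rw [hessianMinor_symProd L hQ] at hP
  have hLx : L x ≠ 0 := fun h0 => hP (by rw [h0]; ring)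
  have hdet : subDet Q x y z ≠ 0 := fun h0 => hP (by rw [h0]; ring)
  by_contra hne
  obtain ⟨w, hw⟩ := Function.ne_iff.1 hne
  -- `l i` and `q i j` are the values of `L` and `Q` at the vectors `u i = L x • e i - L' i • e x`
  -- in the kernel of `L'`
  set l : Fin n → R := fun i => L x * (L i - L' i) with hl
  set q : Fin n → Fin n → R := fun i j =>
    L x ^ 2 * Q i j - L x * L' j * Q i x - L x * L' i * Q x j + L' i * L' j * Q x x with hq
  have key : ∀ i j k, l i * q j k + l j * q i k + l k * q i j = 0 := by
    intro i j k
    have e : ∀ a b c, symProd L Q a b c = symProd L' Q' a b c := fun a b c => by rw [h]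
    have h1 := e i j k
    have h2 := e i j x
    have h3 := e i k x
    have h4 := e j k x
    have h5 := e i x x
    have h6 := e j x x
    have h7 := e k x x
    have h8 := e x x x
    simp only [symProd, ← hx, hQ' j x, hQ' k x, hQ' i x] at h1 h2 h3 h4 h5 h6 h7 h8
    simp only [hl, hq]
    rw [hQ x j, hQ x k]
    linear_combination L x ^ 3 * h1 - L x ^ 2 * L' k * h2 - L x ^ 2 * L' j * h3 -
      L x ^ 2 * L' i * h4 + L x * L' j * L' k * h5 + L x * L' i * L' k * h6 +
      L x * L' i * L' j * h7 - L' i * L' j * L' k * h8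
  have hlw : l w ≠ 0 := mul_ne_zero hLx (sub_ne_zero.2 hw)
  have hww : q w w = 0 := by
    have : (3 : R) * (l w * q w w) = 0 := by linear_combination key w w w
    simpa [hlw] using this
  have hwi : ∀ i, q w i = 0 := fun i => by
    have : (2 : R) * (l w * q w i) = 0 := by linear_combination key w w i - l i * hww
    simpa [hlw] using this
  have h0 : ∀ i j, q i j = 0 := fun i j => by
    have : l w * q i j = 0 := by linear_combination key w i j - l i * hwi j - l j * hwi i
    simpa [hlw] using this
  have hyy := h0 y y
  have hyz := h0 y z
  have hzz := h0 z z
  simp only [hq, hQ y x, hQ z x] at hyy hyz hzz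
  refine hdet ((mul_eq_zero_iff_left (pow_ne_zero 4 hLx)).1 ?_)
  simp only [subDet, hQ y x, hQ z x, hQ z y]
  linear_combination
    (Q x x * L x ^ 2 * Q z z - L x ^ 2 * Q x z ^ 2) * hyy +
    (Q x x * (2 * L x * L' y * Q x y - L' y ^ 2 * Q x x) - L x ^ 2 * Q x y ^ 2) * hzz +
    (2 * L x ^ 2 * Q x y * Q x z - Q x x * (L x ^ 2 * Q y z +
      (L x * L' z * Q x y + L x * L' y * Q x z - L' y * L' z * Q x x))) * hyz

theorem cofactor_unique [IsDomain R] [CharZero R] {L : Fin n → R} {Q Q' : Fin n → Fin n → R}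
    (h : symProd L Q = symProd L Q') {x : Fin n} (hx : L x ≠ 0) : Q = Q' := by
  have e : ∀ a b c, symProd L Q a b c = symProd L Q' a b c := fun a b c => by rw [h]
  have hxx : Q x x = Q' x x := by
    have h1 : (3 : R) * (L x * (Q x x - Q' x x)) = 0 := by
      have := e x x x
      simp only [symProd] at this
      linear_combination this
    simpa [hx, sub_eq_zero] using h1
  have hxi : ∀ i, Q x i = Q' x i := fun i => by
    have h1 : (2 : R) * (L x * (Q x i - Q' x i)) = 0 := by
      have := e x x i
      simp only [symProd] at this
      linear_combination this - L i * hxx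
    simpa [hx, sub_eq_zero] using h1
  funext i j
  have h1 : L x * (Q i j - Q' i j) = 0 := by
    have := e x i j
    simp only [symProd] at this
    linear_combination this - L i * hxi j - L j * hxi i
  simpa [hx, sub_eq_zero] using h1

/-- Every coefficient of a linear factor of a cubic form `K` is a root of a cubic polynomial:
`K` vanishes at the zero `e i - L i • e x` of the factor. -/
theorem symProd_cubic_relation {L : Fin n → R} (Q : Fin n → Fin n → R)
    {x : Fin n} (hx : L x = 1) (i : Fin n) :
    symProd L Q x x x * L i ^ 3 - 3 * symProd L Q x x i * L i ^ 2 +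
      3 * symProd L Q x i i * L i - symProd L Q i i i = 0 := by
  simp only [symProd, hx]
  ring

end LinearFactor

/-! ### A dense parametrization of the second secant variety -/

section Recover

variable {n : ℕ}

/-- The entries of a mean, a covariance, a linear form and a quadratic form are obtained from the
moments they determine, multiplied by `s`, by divisions by `s` and by the third cumulant at
`(x, x, x)`, and by taking roots of monic cubic polynomials. -/
theorem mem_of_cumulantMoments_mem {F : Type*} [CommRing F] [Algebra ℂ F] (T : Subalgebra ℂ F)
    (hT : ∀ a ∈ T, ∀ b ∈ T, ∀ c ∈ T, ∀ y : F, y ^ 3 + a * y ^ 2 + b * y + c = 0 → y ∈ T)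
    {s s' κ' : F} (hs' : s' ∈ T) (hs : s * s' = 1) {m L : Fin n → F} {C Q : Fin n → Fin n → F}
    (hC : ∀ i j, C i j = C j i) (hQ : ∀ i j, Q i j = Q j i) {x : Fin n} (hx : L x = 1)
    (hκ' : κ' ∈ T) (hκ : symProd L Q x x x * κ' = 1)
    (h : ∀ a, s * cumulantMoments m C (symProd L Q) a ∈ T) :
    (∀ i, m i ∈ T) ∧ (∀ i j, C i j ∈ T) ∧ (∀ i, L i ∈ T) ∧ ∀ i j, Q i j ∈ T := by
  have hnum : ∀ (c : ℂ) {y : F}, y ∈ T → algebraMap ℂ F c * y ∈ T := fun c y hy =>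
    T.mul_mem (T.algebraMap_mem c) hy
  have hD : ∀ a, cumulantMoments m C (symProd L Q) a ∈ T := fun a => by
    have := T.mul_mem hs' (h a)
    rwa [← mul_assoc, mul_comm s', hs, one_mul] at this
  have hm : ∀ i, m i ∈ T := fun i => by simpa using hD (MomentIndex.one i)
  have hCm : ∀ i j, C i j ∈ T := fun i j => by
    have := T.sub_mem (hD (MomentIndex.two i j)) (T.mul_mem (hm i) (hm j))
    rwa [cumulantMoments_two hC, add_sub_cancel_right] at this
  have hK : ∀ i j k, symProd L Q i j k ∈ T := fun i j k => by
    have h₁ := T.add_mem (T.add_mem (T.mul_mem (hm i) (hCm j k)) (T.mul_mem (hm j) (hCm i k)))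
      (T.mul_mem (hm k) (hCm i j))
    have h₂ := T.mul_mem (T.mul_mem (hm i) (hm j)) (hm k)
    have := T.sub_mem (T.sub_mem (hD (MomentIndex.three i j k)) h₂) h₁
    rwa [cumulantMoments_three hC (isSymmTensor_symProd hQ), add_sub_cancel_right,
      add_sub_cancel_right] at this
  have h3 : (3 : F) = algebraMap ℂ F 3 := (map_ofNat _ 3).symm
  have hL : ∀ i, L i ∈ T := fun i => by
    refine hT _ (hnum (-3) (T.mul_mem hκ' (hK x x i))) _ (hnum 3 (T.mul_mem hκ' (hK x i i)))
      _ (hnum (-1) (T.mul_mem hκ' (hK i i i))) (L i) ?_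
    simp only [map_neg, map_one, ← h3]
    linear_combination κ' * symProd_cubic_relation Q hx i - L i ^ 3 * hκ
  have e3 : algebraMap ℂ F (1 / 3) * 3 = 1 := by rw [h3, ← map_mul]; norm_num
  have e2 : algebraMap ℂ F (1 / 2) * 2 = 1 := by
    rw [show (2 : F) = algebraMap ℂ F 2 from (map_ofNat _ 2).symm, ← map_mul]; norm_num
  have hQxx : Q x x ∈ T := by
    have := hnum (1 / 3) (hK x x x)
    have e : algebraMap ℂ F (1 / 3) * symProd L Q x x x = Q x x := by
      simp only [symProd, hx]; linear_combination Q x x * e3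
    rwa [e] at this
  have hQxi : ∀ i, Q x i ∈ T := fun i => by
    have := hnum (1 / 2) (T.sub_mem (hK x x i) (T.mul_mem (hL i) hQxx))
    have e : algebraMap ℂ F (1 / 2) * (symProd L Q x x i - L i * Q x x) = Q x i := by
      simp only [symProd, hx]; linear_combination Q x i * e2
    rwa [e] at this
  refine ⟨hm, hCm, hL, fun i j => ?_⟩
  have := T.sub_mem (T.sub_mem (hK x i j) (T.mul_mem (hL i) (hQxi j))) (T.mul_mem (hL j) (hQxi i))
  have e : symProd L Q x i j - L i * Q x j - L j * Q x i = Q i j := by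
    simp only [symProd, hx]; ring
  rwa [e] at this

open MvPolynomial in
/-- The form of degree three in the moments that gives the third cumulants when `m_0 = 1`. -/
noncomputable def cumulantForm (i j k : Fin n) : MvPolynomial (MomentIndex n 3) ℂ :=
  X (MomentIndex.zero n 3) ^ 2 * X (MomentIndex.three i j k) -
      X (MomentIndex.zero n 3) * (X (MomentIndex.one i) * X (MomentIndex.two j k) +
        X (MomentIndex.one j) * X (MomentIndex.two i k) +
        X (MomentIndex.one k) * X (MomentIndex.two i j)) +
    2 * (X (MomentIndex.one i) * X (MomentIndex.one j) * X (MomentIndex.one k))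

open MvPolynomial in
theorem isHomogeneous_cumulantForm (i j k : Fin n) : (cumulantForm i j k).IsHomogeneous 3 := by
  have hX : ∀ a : MomentIndex n 3, (X a : MvPolynomial (MomentIndex n 3) ℂ).IsHomogeneous 1 :=
    fun a => isHomogeneous_X ℂ a
  refine ((((hX _).pow 2).mul (hX _)).sub ((hX _).mul
    ((((hX _).mul (hX _)).add ((hX _).mul (hX _))).add ((hX _).mul (hX _))))).add ?_
  have h2 : (2 : MvPolynomial (MomentIndex n 3) ℂ).IsHomogeneous 0 := by
    rw [show (2 : MvPolynomial (MomentIndex n 3) ℂ) = C 2 from rfl]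
    exact isHomogeneous_C _ 2
  exact h2.mul (((hX _).mul (hX _)).mul (hX _))

theorem aeval_cumulantForm {F : Type*} [CommRing F] [Algebra ℂ F] (s : F) (m : Fin n → F)
    {C : Fin n → Fin n → F} {K : Fin n → Fin n → Fin n → F} (hC : ∀ i j, C i j = C j i)
    (hK : IsSymmTensor K) (i j k : Fin n) :
    MvPolynomial.aeval (fun a => s * cumulantMoments m C K a) (cumulantForm i j k) =
      s ^ 3 * K i j k := by
  simp only [cumulantForm, map_add, map_sub, map_mul, map_pow, MvPolynomial.aeval_X, map_ofNat,
    cumulantMoments_zero, cumulantMoments_one, cumulantMoments_two hC,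
    cumulantMoments_three hC hK]
  ring

end Recover

section Parametrization

variable {n : ℕ}

theorem moments_eq_sum {k : ℕ} (θ : MixtureParam n k) :
    θ.moments 3 = ∑ l, θ.weight l •
      cumulantMoments (θ.mean l) (fun i j => θ.cov l i j) (fun _ _ _ => 0) := by
  funext a
  simp only [MixtureParam.moments, Finset.sum_apply, Pi.smul_apply, smul_eq_mul,
    ← gaussianMoment_eq _ (θ.cov_symm _)]

/-- The mixture of two Gaussians with weights `w` and `1 - w`. -/
def mixtureTwo (w : ℂ) (μ ν : Fin n → ℂ) (σ τ : Fin n → Fin n → ℂ) (hσ : ∀ i j, σ i j = σ j i)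
    (hτ : ∀ i j, τ i j = τ j i) : MixtureParam n 2 where
  weight := ![w, 1 - w]
  mean := ![μ, ν]
  cov := ![Matrix.of σ, Matrix.of τ]
  sum_weight := by simp
  cov_symm := by
    intro l
    fin_cases l
    · exact Matrix.IsSymm.ext fun i j => hσ j i
    · exact Matrix.IsSymm.ext fun i j => hτ j i

theorem moments_mixtureTwo (w : ℂ) (μ ν : Fin n → ℂ) (σ τ : Fin n → Fin n → ℂ)
    (hσ : ∀ i j, σ i j = σ j i) (hτ : ∀ i j, τ i j = τ j i) :
    (mixtureTwo w μ ν σ τ hσ hτ).moments 3 = w • cumulantMoments μ σ (fun _ _ _ => 0) +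
      (1 - w) • cumulantMoments ν τ (fun _ _ _ => 0) := by
  rw [moments_eq_sum, Fin.sum_univ_two]
  rfl

/-- The moments of a mixture of two Gaussians in terms of its parameters. -/
theorem moments_two (θ : MixtureParam n 2) : ∃ (w : ℂ) (σ τ : Fin n → Fin n → ℂ),
    w = θ.weight 0 ∧ θ.weight 1 = 1 - w ∧ θ.cov 0 = Matrix.of σ ∧ θ.cov 1 = Matrix.of τ ∧
    (∀ i j, σ i j = σ j i) ∧ (∀ i j, τ i j = τ j i) ∧
    θ.moments 3 = w • cumulantMoments (θ.mean 0) σ (fun _ _ _ => 0) +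
      (1 - w) • cumulantMoments (θ.mean 1) τ (fun _ _ _ => 0) := by
  have hw : θ.weight 1 = 1 - θ.weight 0 := by
    rw [← θ.sum_weight, Fin.sum_univ_two]; ring
  refine ⟨θ.weight 0, fun i j => θ.cov 0 i j, fun i j => θ.cov 1 i j, rfl, hw, rfl, rfl,
    fun i j => (θ.cov_symm 0).apply j i, fun i j => (θ.cov_symm 1).apply j i, ?_⟩
  rw [moments_eq_sum, Fin.sum_univ_two, hw]

theorem exists_mixtureTwo (m : Fin n → ℂ) {C : Fin n → Fin n → ℂ} (hC : ∀ i j, C i j = C j i)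
    (L : Fin n → ℂ) {Q : Fin n → Fin n → ℂ} (hQ : ∀ i j, Q i j = Q j i) :
    ∃ θ : MixtureParam n 2, θ.moments 3 = cumulantMoments m C (symProd L Q) := by
  obtain ⟨σ, τ, hσ, hτ, h⟩ := cumulantMoments_eq_mixture_two (w := 1 / 2) (by norm_num)
    (by norm_num) m hC L hQ
  exact ⟨mixtureTwo _ _ _ σ τ hσ hτ, by rw [moments_mixtureTwo, h]⟩

theorem exists_cumulantMoments (θ : MixtureParam n 2) :
    ∃ (m L : Fin n → ℂ) (C Q : Fin n → Fin n → ℂ), (∀ i j, C i j = C j i) ∧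
      (∀ i j, Q i j = Q j i) ∧ θ.moments 3 = cumulantMoments m C (symProd L Q) := by
  obtain ⟨w, σ, τ, -, -, -, -, hσ, hτ, h⟩ := moments_two θ
  rw [mixture_two_eq_cumulantMoments w _ _ hσ hτ] at h
  refine ⟨_, _, _, _, fun i j => ?_, fun i j => ?_, h⟩
  · rw [hσ i j, hτ i j]; ring
  · rw [hσ i j, hτ i j]; ring

/-- The variables of a parametrization of the cone over the second secant variety: a scaling factor,
a mean, a covariance, the coefficients of a linear form that is normalized by its value `1` at `x`,
and a quadratic form. -/
abbrev CubicVar (x : Fin n) : Type :=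
  Unit ⊕ Fin n ⊕ Sym2 (Fin n) ⊕ {i : Fin n // i ≠ x} ⊕ Sym2 (Fin n)

namespace CubicVar

open MvPolynomial

variable (x : Fin n)

/-- The scaling factor. -/
noncomputable def scale : MvPolynomial (CubicVar x) ℂ := X (Sum.inl ())

/-- The entries of the mean. -/
noncomputable def mean (i : Fin n) : MvPolynomial (CubicVar x) ℂ := X (Sum.inr (Sum.inl i))

/-- The entries of the covariance. -/
noncomputable def cov (i j : Fin n) : MvPolynomial (CubicVar x) ℂ :=
  X (Sum.inr (Sum.inr (Sum.inl s(i, j))))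

/-- The coefficients of the linear form. -/
noncomputable def lin (i : Fin n) : MvPolynomial (CubicVar x) ℂ :=
  if h : i = x then 1 else X (Sum.inr (Sum.inr (Sum.inr (Sum.inl ⟨i, h⟩))))

/-- The coefficients of the quadratic form. -/
noncomputable def quad (i j : Fin n) : MvPolynomial (CubicVar x) ℂ :=
  X (Sum.inr (Sum.inr (Sum.inr (Sum.inr s(i, j)))))

theorem cov_symm (i j : Fin n) : cov x i j = cov x j i := by rw [cov, cov, Sym2.eq_swap]

theorem quad_symm (i j : Fin n) : quad x i j = quad x j i := by rw [quad, quad, Sym2.eq_swap]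

@[simp] theorem lin_self : lin x x = 1 := by simp [lin]

theorem card_eq : Fintype.card (CubicVar x) = n * (n + 3) := by
  have hn : 1 ≤ n := Fin.pos x
  have h2 : (n + 1).choose 2 * 2 = n * (n + 1) := by
    rw [Nat.choose_two_right, Nat.div_mul_cancel]
    · simp [mul_comm]
    · simpa [mul_comm] using (Nat.even_mul_succ_self n).two_dvd
  simp only [Fintype.card_sum, Sym2.card, Fintype.card_fin, Fintype.card_unit,
    Fintype.card_subtype_compl, Fintype.card_subtype_eq]
  have : n * (n + 3) = n * (n + 1) + 2 * n := by ring
  omega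

/-- The point of the affine space of the variables with given entries. The value `L x` is not used,
as it is not a variable. -/
noncomputable def point (s : ℂ) (m : Fin n → ℂ) (C : Fin n → Fin n → ℂ) (L : Fin n → ℂ)
    (Q : Fin n → Fin n → ℂ) (hC : ∀ i j, C i j = C j i) (hQ : ∀ i j, Q i j = Q j i) :
    CubicVar x → ℂ :=
  Sum.elim (fun _ => s) (Sum.elim m (Sum.elim (Sym2.lift ⟨C, hC⟩)
    (Sum.elim (fun i => L i) (Sym2.lift ⟨Q, hQ⟩))))

/-- The homomorphism of coordinate rings that belongs to the parametrization. -/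
noncomputable def param : MvPolynomial (MomentIndex n 3) ℂ →ₐ[ℂ] MvPolynomial (CubicVar x) ℂ :=
  aeval fun a => scale x * cumulantMoments (mean x) (cov x) (symProd (lin x) (quad x)) a

variable {x}

theorem map_param {F : Type*} [CommRing F] [Algebra ℂ F]
    (ψ : MvPolynomial (CubicVar x) ℂ →ₐ[ℂ] F) (f : MvPolynomial (MomentIndex n 3) ℂ) :
    ψ (param x f) = aeval (fun a => ψ (scale x) * cumulantMoments (fun i => ψ (mean x i))
      (fun i j => ψ (cov x i j))
      (symProd (fun i => ψ (lin x i)) (fun i j => ψ (quad x i j))) a) f := by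
  have : (ψ.comp (param x)) = aeval (fun a => ψ (scale x) * cumulantMoments
      (fun i => ψ (mean x i)) (fun i j => ψ (cov x i j))
      (symProd (fun i => ψ (lin x i)) (fun i j => ψ (quad x i j))) a) := by
    refine MvPolynomial.algHom_ext fun a => ?_
    have h := map_cumulantMoments (c₁ := mean x) (c₂ := cov x)
      (c₃ := symProd (lin x) (quad x)) ψ.toRingHom a
    simp only [AlgHom.toRingHom_eq_coe, RingHom.coe_coe, symProd, map_add, map_mul] at h
    simp only [AlgHom.comp_apply, param, aeval_X, map_mul, h]
    rfl
  rw [← this]; rfl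

theorem eval_param (f : MvPolynomial (MomentIndex n 3) ℂ) {s : ℂ} {m : Fin n → ℂ}
    {C : Fin n → Fin n → ℂ} {L : Fin n → ℂ} {Q : Fin n → Fin n → ℂ} (hC : ∀ i j, C i j = C j i)
    (hQ : ∀ i j, Q i j = Q j i) (hL : L x = 1) :
    eval (point x s m C L Q hC hQ) (param x f) =
      eval (s • cumulantMoments m C (symProd L Q)) f := by
  have h := map_param (aeval (point x s m C L Q hC hQ)) f
  rw [← coe_aeval_eq_eval, ← coe_aeval_eq_eval]
  refine h.trans ?_
  have hl : (fun i => aeval (point x s m C L Q hC hQ) (lin x i)) = L := by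
    funext i
    by_cases hi : i = x
    · subst hi; simp [hL]
    · simp [lin, hi, point]
  rw [hl]
  simp only [scale, mean, cov, quad, aeval_X]
  rfl

theorem continuous_cumulantMoments_symProd (m : Fin n → ℂ) (C Q : Fin n → Fin n → ℂ)
    {L : ℂ → Fin n → ℂ} (hL : Continuous L) :
    Continuous fun u => cumulantMoments m C (symProd (L u) Q) := by
  refine continuous_pi fun a => ?_
  unfold cumulantMoments momentVector symProd
  split <;> fun_prop

/-- The image of the parametrization is dense in the cone over the secant variety. -/
theorem param_eq_zero_iff (f : MvPolynomial (MomentIndex n 3) ℂ) :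
    param x f = 0 ↔
      ∀ (θ : MixtureParam n 2) (t : ℂ), eval (t • θ.moments 3) f = 0 := by
  constructor
  · intro hf θ t
    obtain ⟨m, L, C, Q, hC, hQ, h⟩ := exists_cumulantMoments θ
    rw [h]
    have hc : Continuous fun u : ℂ =>
        t • cumulantMoments m C (symProd (Function.update L x u) Q) :=
      (continuous_cumulantMoments_symProd m C Q
        (continuous_const.update x continuous_id)).const_smul t
    have := eval_eq_zero_of_punctured_line f hc 0 (fun u hu => ?_) (L x)
    · simpa using this
    -- the linear form can be normalized, as its value `u` at `x` is not zero
    · have hQ' : ∀ i j, u * Q i j = u * Q j i := fun i j => by rw [hQ]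
      have h₁ := eval_param (x := x) f (s := t) (m := m) (L := u⁻¹ • Function.update L x u) hC hQ'
        (by simp [hu])
      rw [hf, map_zero] at h₁
      have e : symProd (Function.update L x u) Q =
          symProd (u⁻¹ • Function.update L x u) fun i j => u * Q i j := by
        funext i j k
        simp only [symProd, Pi.smul_apply, smul_eq_mul]
        field_simp
      rw [e, ← h₁]
  · intro h
    refine MvPolynomial.funext fun v => ?_
    have hC : ∀ i j : Fin n, v (Sum.inr (Sum.inr (Sum.inl s(i, j)))) =
      v (Sum.inr (Sum.inr (Sum.inl s(j, i)))) := fun i j => by rw [Sym2.eq_swap]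
    have hQ : ∀ i j : Fin n, v (Sum.inr (Sum.inr (Sum.inr (Sum.inr s(i, j))))) =
      v (Sum.inr (Sum.inr (Sum.inr (Sum.inr s(j, i))))) := fun i j => by rw [Sym2.eq_swap]
    let L : Fin n → ℂ := fun i =>
      if h : i = x then 1 else v (Sum.inr (Sum.inr (Sum.inr (Sum.inl ⟨i, h⟩))))
    have hv : v = point x (v (Sum.inl ())) (fun i => v (Sum.inr (Sum.inl i))) _ L _ hC hQ := by
      funext w
      rcases w with w | w | w | w | w
      · rfl
      · rfl
      · induction w with | _ i j => rfl
      · simp [point, L, w.2]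
      · induction w with | _ i j => rfl
    rw [hv, eval_param f hC hQ (by simp [L]), map_zero]
    obtain ⟨θ, hθ⟩ := exists_mixtureTwo (fun i => v (Sum.inr (Sum.inl i))) hC L hQ
    rw [← hθ]
    exact h θ _

end CubicVar

end Parametrization

/-! ### The dimension of the second secant variety -/

section Integrality

theorem isIntegral_of_cubic {A F : Type*} [CommRing A] [CommRing F] [Algebra A F] {a b c y : F}
    (ha : IsIntegral A a) (hb : IsIntegral A b) (hc : IsIntegral A c)
    (h : y ^ 3 + a * y ^ 2 + b * y + c = 0) : IsIntegral A y := by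
  let T := integralClosure A F
  have : IsIntegral T y := by
    refine ⟨Polynomial.X ^ 3 + Polynomial.C (⟨a, ha⟩ : T) * Polynomial.X ^ 2 +
      Polynomial.C (⟨b, hb⟩ : T) * Polynomial.X + Polynomial.C (⟨c, hc⟩ : T), by monicity!, ?_⟩
    simp only [Polynomial.eval₂_add, Polynomial.eval₂_mul, Polynomial.eval₂_pow,
      Polynomial.eval₂_X, Polynomial.eval₂_C]
    exact h
  exact isIntegral_trans y this

theorem isAlgebraic_of_cubic {A F : Type*} [CommRing A] [IsDomain A] [Field F] [Algebra A F]
    {a b c y : F} (ha : IsAlgebraic A a) (hb : IsAlgebraic A b) (hc : IsAlgebraic A c)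
    (h : y ^ 3 + a * y ^ 2 + b * y + c = 0) : IsAlgebraic A y := by
  let T := Subalgebra.algebraicClosure A F
  have : IsIntegral T y := isIntegral_of_cubic (A := T) (a := a) (b := b) (c := c)
    (isIntegral_algebraMap (x := (⟨a, ha⟩ : T))) (isIntegral_algebraMap (x := (⟨b, hb⟩ : T)))
    (isIntegral_algebraMap (x := (⟨c, hc⟩ : T))) h
  exact this.isAlgebraic.restrictScalars A

end Integrality

namespace CubicVar

open MvPolynomial

variable {n : ℕ} (x : Fin n)

theorem param_X_zero : param x (X (MomentIndex.zero n 3)) = scale x := by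
  simp [param]

theorem param_cumulantForm (i j k : Fin n) :
    param x (cumulantForm i j k) = scale x ^ 3 * symProd (lin x) (quad x) i j k :=
  aeval_cumulantForm _ _ (cov_symm x) (isSymmTensor_symProd (quad_symm x)) i j k

theorem scale_ne_zero : scale x ≠ 0 := X_ne_zero _

theorem symProd_ne_zero : symProd (lin x) (quad x) x x x ≠ 0 := by
  have : symProd (lin x) (quad x) x x x = C 3 * quad x x x := by
    rw [show (C 3 : MvPolynomial (CubicVar x) ℂ) = 3 from rfl]
    simp only [symProd, lin_self]; ring
  rw [this]
  exact mul_ne_zero (by simp) (X_ne_zero _)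

/-- A subalgebra that contains the entries of the parametrization contains all polynomials. -/
theorem algHom_mem {F : Type*} [CommRing F] [Algebra ℂ F] (T : Subalgebra ℂ F)
    (ψ : MvPolynomial (CubicVar x) ℂ →ₐ[ℂ] F) (hs : ψ (scale x) ∈ T) (hm : ∀ i, ψ (mean x i) ∈ T)
    (hC : ∀ i j, ψ (cov x i j) ∈ T) (hL : ∀ i, ψ (lin x i) ∈ T) (hQ : ∀ i j, ψ (quad x i j) ∈ T)
    (p : MvPolynomial (CubicVar x) ℂ) : ψ p ∈ T := by
  induction p using MvPolynomial.induction_on with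
  | C a => rw [← MvPolynomial.algebraMap_eq, AlgHom.commutes]; exact T.algebraMap_mem a
  | add p q hp hq => rw [map_add]; exact T.add_mem hp hq
  | mul_X p w hp =>
    rw [map_mul]
    refine T.mul_mem hp ?_
    rcases w with w | w | w | w | w
    · exact hs
    · exact hm w
    · induction w with | _ i j => exact hC i j
    · have := hL w
      rwa [lin, dif_neg w.2] at this
    · induction w with | _ i j => exact hQ i j

/-- All polynomials are obtained from the image of the parametrization by taking roots of monic
cubics and by inverting `m_0` and the third cumulant at `(x, x, x)`. -/
theorem algHom_mem_of_inv_mem {F : Type*} [CommRing F] [Algebra ℂ F] (T : Subalgebra ℂ F)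
    (hT : ∀ a ∈ T, ∀ b ∈ T, ∀ c ∈ T, ∀ y : F, y ^ 3 + a * y ^ 2 + b * y + c = 0 → y ∈ T)
    (ψ : MvPolynomial (CubicVar x) ℂ →ₐ[ℂ] F) (h : ∀ f, ψ (param x f) ∈ T) {u : F} (hu : u ∈ T)
    (hmul : ψ (param x (X (MomentIndex.zero n 3) * cumulantForm x x x)) * u = 1)
    (p : MvPolynomial (CubicVar x) ℂ) : ψ p ∈ T := by
  have hs : ψ (scale x) ∈ T := by rw [← param_X_zero]; exact h _
  have hκ := h (cumulantForm x x x)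
  rw [map_mul, param_X_zero, param_cumulantForm] at hmul
  rw [param_cumulantForm] at hκ
  have hmap : ψ (symProd (lin x) (quad x) x x x) =
      symProd (fun i => ψ (lin x i)) (fun i j => ψ (quad x i j)) x x x := by
    simp [symProd]
  simp only [map_mul, map_pow] at hmul hκ
  obtain ⟨hm, hC, hL, hQ⟩ := mem_of_cumulantMoments_mem T hT (s := ψ (scale x))
    (s' := ψ (scale x) ^ 3 * ψ (symProd (lin x) (quad x) x x x) * u)
    (κ' := ψ (scale x) ^ 4 * u) (m := fun i => ψ (mean x i)) (C := fun i j => ψ (cov x i j))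
    (L := fun i => ψ (lin x i)) (Q := fun i j => ψ (quad x i j)) (x := x)
    (T.mul_mem hκ hu) (by linear_combination hmul)
    (fun i j => by rw [cov_symm]) (fun i j => by rw [quad_symm]) (by simp)
    (T.mul_mem (T.pow_mem hs 4) hu) (by rw [← hmap]; linear_combination hmul)
    (fun a => by
      have := h (X a)
      rwa [map_param, aeval_X] at this)
  exact algHom_mem x T ψ hs hm hC hL hQ p

theorem isAlgebraic_range_param :
    Algebra.IsAlgebraic (param x).range (MvPolynomial (CubicVar x) ℂ) := by
  let F := FractionRing (MvPolynomial (CubicVar x) ℂ)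
  let T : Subalgebra ℂ F :=
    (Subalgebra.algebraicClosure (param x).range F).restrictScalars ℂ
  have hmem : ∀ y, y ∈ T ↔ IsAlgebraic (param x).range y := fun y => Iff.rfl
  let ψ : MvPolynomial (CubicVar x) ℂ →ₐ[ℂ] F := IsScalarTower.toAlgHom ℂ _ F
  have h : ∀ f, ψ (param x f) ∈ T := fun f =>
    (hmem _).2 (isAlgebraic_algebraMap (⟨param x f, f, rfl⟩ : (param x).range))
  have hne : ψ (param x (X (MomentIndex.zero n 3) * cumulantForm x x x)) ≠ 0 := by
    rw [map_mul, param_X_zero, param_cumulantForm]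
    refine (map_ne_zero_iff ψ (IsFractionRing.injective _ F)).2 ?_
    exact mul_ne_zero (scale_ne_zero x) (mul_ne_zero (pow_ne_zero 3 (scale_ne_zero x))
      (symProd_ne_zero x))
  refine ⟨fun p => ?_⟩
  have := algHom_mem_of_inv_mem x T (fun a ha b hb c hc y hy =>
    (hmem _).2 (isAlgebraic_of_cubic ((hmem a).1 ha) ((hmem b).1 hb) ((hmem c).1 hc) hy)) ψ h
    (u := (ψ (param x (X (MomentIndex.zero n 3) * cumulantForm x x x)))⁻¹)
    ((hmem _).2 ((hmem _).1 (h _)).inv) (mul_inv_cancel₀ hne) p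
  exact (isAlgebraic_algebraMap_iff (IsFractionRing.injective _ F)).1 ((hmem _).1 this)

theorem trdeg_range_param :
    Algebra.trdeg ℂ (param x).range = (n * (n + 3) : ℕ) := by
  have := isAlgebraic_range_param x
  have : FaithfulSMul ℂ (param x).range :=
    (faithfulSMul_iff_algebraMap_injective _ _).2 (algebraMap ℂ (param x).range).injective
  have h := trdeg_add_eq ℂ (param x).range (A := MvPolynomial (CubicVar x) ℂ)
  rw [trdeg_eq_zero (R := (param x).range), add_zero, MvPolynomial.trdeg_of_isDomain] at h
  rw [h, Cardinal.mk_fintype, card_eq, Cardinal.lift_natCast]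

theorem span_vanishingForms_eq_ker :
    Ideal.span (vanishingForms (gaussianSecant n 3 2)) = RingHom.ker (param x) := by
  ext f
  rw [mem_span_vanishingForms_iff, RingHom.mem_ker, param_eq_zero_iff]

theorem projDim_gaussianSecant_two (hn : 1 ≤ n) :
    projDim (gaussianSecant n 3 2) = n * (n + 3) - 1 := by
  let x : Fin n := ⟨0, hn⟩
  have e : HomogeneousCoordinateRing (gaussianSecant n 3 2) ≃ₐ[ℂ] (param x).range :=
    (Ideal.quotientEquivAlgOfEq ℂ (span_vanishingForms_eq_ker x)).trans
      (Ideal.quotientKerEquivRange (param x))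
  rw [projDim, e.trdeg_eq, trdeg_range_param, Cardinal.toNat_natCast]

end CubicVar

/-! ### Lifting points along a parametrization that is integral after a localization -/

section Lifting

/-- If `R` becomes integral over `A` after `G` is inverted, then every point of the closure of the
image of `Spec R → Spec A` at which `G` does not vanish belongs to the image, by lying over. -/
theorem exists_algHom_comp_eq {k A R : Type*} [Field k] [IsAlgClosed k] [CommRing A] [CommRing R]
    [Algebra k A] [Algebra k R] (Φ : A →ₐ[k] R) (χ : A →ₐ[k] k)
    (hker : ∀ f, Φ f = 0 → χ f = 0) (G : A) (hG : χ G ≠ 0)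
    (hint : ∀ r : R, (IsLocalization.Away.map (Localization.Away G) (Localization.Away (Φ G))
      Φ.toRingHom G).IsIntegralElem (algebraMap R _ r)) :
    ∃ ψ : R →ₐ[k] k, ∀ f, ψ (Φ f) = χ f := by
  let A' := Localization.Away G
  let R' := Localization.Away (Φ G)
  let g : A' →+* R' := IsLocalization.Away.map A' R' Φ.toRingHom G
  have hg : ∀ f, g (algebraMap A A' f) = algebraMap R R' (Φ f) := fun f =>
    IsLocalization.map_eq _ f
  have hgk : ∀ c : k, g (algebraMap k A' c) = algebraMap k R' c := fun c => by
    rw [IsScalarTower.algebraMap_apply k A A', hg, AlgHom.commutes,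
      ← IsScalarTower.algebraMap_apply]
  let χ' : A' →+* k := IsLocalization.Away.lift G (g := χ.toRingHom) (isUnit_iff_ne_zero.2 hG)
  have hχ : ∀ f, χ' (algebraMap A A' f) = χ f := fun f => IsLocalization.Away.lift_eq _ _ f
  have hχk : ∀ c : k, χ' (algebraMap k A' c) = c := fun c => by
    rw [IsScalarTower.algebraMap_apply k A A', hχ, AlgHom.commutes]; rfl
  let : Algebra A' R' := g.toAlgebra
  have halg : algebraMap A' R' = g := rfl
  have : (RingHom.ker χ').IsMaximal :=
    RingHom.ker_isMaximal_of_surjective χ' fun c => ⟨_, hχk c⟩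
  have : Algebra.IsIntegral A' R' := by
    refine ⟨fun z => ?_⟩
    obtain ⟨N, r, hz⟩ := IsLocalization.Away.surj (Φ G) z
    have h₁ : algebraMap R R' (Φ G) * g (IsLocalization.Away.invSelf G) = 1 := by
      rw [← hg, ← map_mul, IsLocalization.Away.mul_invSelf, map_one]
    have h₂ : z = algebraMap R R' r * g (IsLocalization.Away.invSelf G) ^ N := by
      rw [← hz, mul_assoc, ← mul_pow, h₁, one_pow, mul_one]
    rw [h₂]
    exact IsIntegral.mul (hint r) (IsIntegral.pow isIntegral_algebraMap N)
  obtain ⟨Q, hQ, hQc⟩ := Ideal.exists_ideal_over_maximal_of_isIntegral (S := R')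
    (RingHom.ker χ') (by
    intro z hz
    obtain ⟨N, a, hz'⟩ := IsLocalization.Away.surj G z
    rw [RingHom.mem_ker, halg] at hz
    have h₁ : algebraMap R R' (Φ a) = 0 := by
      rw [← hg, ← hz', map_mul, hz, zero_mul]
    obtain ⟨⟨_, M, rfl⟩, hM⟩ := (IsLocalization.map_eq_zero_iff (Submonoid.powers (Φ G)) R' _).1 h₁
    have h₂ : χ (G ^ M * a) = 0 := hker _ (by rw [map_mul, map_pow]; exact hM)
    have h₃ : χ a = 0 := by simpa [hG] using h₂
    have h₄ : χ' z * χ G ^ N = 0 := by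
      rw [← h₃, ← hχ a, ← hz', map_mul, map_pow, hχ]
    rw [RingHom.mem_ker]
    simpa [hG] using h₄)
  have hres : ∀ a : A', Ideal.Quotient.mk Q (g a) = algebraMap k (R' ⧸ Q) (χ' a) := by
    intro a
    have h₁ : a - algebraMap k A' (χ' a) ∈ RingHom.ker χ' := by
      rw [RingHom.mem_ker, map_sub, hχk, sub_self]
    rw [← hQc, Ideal.mem_comap, halg, map_sub, hgk, ← Ideal.Quotient.eq] at h₁
    exact h₁
  have : Algebra.IsIntegral k (R' ⧸ Q) := by
    refine ⟨fun z => ?_⟩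
    obtain ⟨z, rfl⟩ := Ideal.Quotient.mk_surjective z
    obtain ⟨p, hp, hpz⟩ := Algebra.IsIntegral.isIntegral (R := A') z
    refine ⟨p.map χ', hp.map χ', ?_⟩
    rw [Polynomial.eval₂_map, show (algebraMap k (R' ⧸ Q)).comp χ' =
      (Ideal.Quotient.mk Q).comp g from RingHom.ext fun a => (hres a).symm,
      ← Polynomial.hom_eval₂, ← halg, hpz, map_zero]
  let e : k ≃ₐ[k] (R' ⧸ Q) := AlgEquiv.ofBijective (Algebra.ofId k (R' ⧸ Q))
    (IsAlgClosed.algebraMap_bijective_of_isIntegral (k := k) (K := R' ⧸ Q))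
  refine ⟨(e.symm.toAlgHom.comp (Ideal.Quotient.mkₐ k Q)).comp (IsScalarTower.toAlgHom k R R'),
    fun f => ?_⟩
  change e.symm (Ideal.Quotient.mk Q (algebraMap R R' (Φ f))) = χ f
  rw [← hg, hres, hχ]
  exact e.symm_apply_eq.2 rfl

end Lifting

namespace CubicVar

open MvPolynomial

variable {n : ℕ}

/-- A point of the secant variety with `m_0 = 1` whose third cumulant does not vanish at
`(x, x, x)` has a third cumulant with a linear factor. -/
theorem exists_eq_cumulantMoments {m : MomentIndex n 3 → ℂ} {hm : m ≠ 0}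
    (h : Projectivization.mk ℂ m hm ∈ gaussianSecant n 3 2) (h₀ : m (MomentIndex.zero n 3) = 1)
    {x : Fin n} (hκ : eval m (cumulantForm x x x) ≠ 0) :
    ∃ (c L : Fin n → ℂ) (C Q : Fin n → Fin n → ℂ), (∀ i j, C i j = C j i) ∧
      (∀ i j, Q i j = Q j i) ∧ L x = 1 ∧ m = cumulantMoments c C (symProd L Q) := by
  set G : MvPolynomial (MomentIndex n 3) ℂ := X (MomentIndex.zero n 3) * cumulantForm x x x
  let A' := Localization.Away G
  let R' := Localization.Away (param x G)
  let g : A' →+* R' := IsLocalization.Away.map A' R' (param x).toRingHom G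
  have hg : ∀ f, g (algebraMap _ A' f) = algebraMap _ R' (param x f) := fun f =>
    IsLocalization.map_eq _ f
  let : Algebra A' R' := g.toAlgebra
  have halg : algebraMap A' R' = g := rfl
  have : IsScalarTower ℂ A' R' := IsScalarTower.of_algebraMap_eq fun c => by
    rw [halg, IsScalarTower.algebraMap_apply ℂ (MvPolynomial (MomentIndex n 3) ℂ) A', hg,
      AlgHom.commutes, ← IsScalarTower.algebraMap_apply]
  let T : Subalgebra ℂ R' := (integralClosure A' R').restrictScalars ℂ
  have hmem : ∀ y, y ∈ T ↔ IsIntegral A' y := fun y => Iff.rfl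
  let ι : MvPolynomial (CubicVar x) ℂ →ₐ[ℂ] R' := IsScalarTower.toAlgHom ℂ _ R'
  have hint : ∀ p, ι p ∈ T := by
    refine algHom_mem_of_inv_mem x T (fun a ha b hb c hc y hy =>
      isIntegral_of_cubic (A := A') ha hb hc hy) ι (fun f => ?_)
      (u := g (IsLocalization.Away.invSelf G)) ?_ ?_
    · rw [hmem]
      change IsIntegral A' (algebraMap _ R' (param x f))
      rw [← hg, ← halg]
      exact isIntegral_algebraMap
    · rw [hmem, ← halg]
      exact isIntegral_algebraMap
    · change algebraMap _ R' (param x G) * _ = 1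
      rw [← hg, ← map_mul, IsLocalization.Away.mul_invSelf, map_one]
  obtain ⟨ψ, hψ⟩ := exists_algHom_comp_eq (param x) (aeval m) (fun f hf => by
      rw [param_eq_zero_iff] at hf
      rw [aeval_eq_eval]
      exact eval_eq_zero_of_mem_gaussianSecant h hf) G
    (by simpa [G, aeval_eq_eval, h₀] using hκ) hint
  have hs : ψ (scale x) = 1 := by
    rw [← param_X_zero, hψ, aeval_X, h₀]
  refine ⟨fun i => ψ (mean x i), fun i => ψ (lin x i), fun i j => ψ (cov x i j),
    fun i j => ψ (quad x i j), fun i j => congrArg ψ (cov_symm x i j),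
    fun i j => congrArg ψ (quad_symm x i j),
    by simp, ?_⟩
  funext a
  have := hψ (X a)
  rw [map_param, aeval_X, aeval_X, hs, one_mul] at this
  exact this.symm

end CubicVar

/-! ### Defectivity -/

section Count

/-- A multi-index of degree at most `d` corresponds to a multiset of size `d` of coordinates and
copies of one further symbol `none`. -/
theorem exists_injective_momentIndex (n d : ℕ) :
    ∃ f : MomentIndex n d → Sym (Option (Fin n)) d, Function.Injective f := by
  refine ⟨fun a => ⟨(Finsupp.toMultiset a.1).map some + Multiset.replicate (d - a.1.degree) none,
    ?_⟩, fun a b h => ?_⟩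
  · have : Multiset.card (Finsupp.toMultiset a.1) = a.1.degree := by
      simp [Finsupp.card_toMultiset, Finsupp.degree_apply, Finsupp.sum]
    rw [Multiset.card_add, Multiset.card_map, Multiset.card_replicate, this]
    have := a.2
    omega
  · have h' := congrArg (fun s : Sym (Option (Fin n)) d => Multiset.filterMap id s.1) h
    have hrep : ∀ r : ℕ, Multiset.filterMap id (Multiset.replicate r (none : Option (Fin n))) = 0 :=
      fun r => Multiset.eq_zero_of_forall_notMem fun x hx => by
        obtain ⟨y, hy, hyx⟩ := (Multiset.mem_filterMap _ _ ).1 hx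
        rw [Multiset.eq_of_mem_replicate hy] at hyx
        simp at hyx
    simp only [Multiset.filterMap_add, hrep, add_zero, Multiset.filterMap_map,
      Function.id_comp, Multiset.filterMap_some] at h'
    exact Subtype.ext (by simpa using congrArg Multiset.toFinsupp h')

instance (n d : ℕ) : Finite (MomentIndex n d) := by
  obtain ⟨f, hf⟩ := exists_injective_momentIndex n d
  exact Finite.of_injective f hf

theorem card_momentIndex_le (n d : ℕ) : Nat.card (MomentIndex n d) ≤ (n + d).choose d := by
  obtain ⟨f, hf⟩ := exists_injective_momentIndex n d
  refine (Nat.card_le_card_of_injective f hf).trans ?_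
  rw [Nat.card_eq_fintype_card, Sym.card_sym_eq_choose]
  simp [add_right_comm]

/-- The image of a homomorphism of polynomial rings that is not injective has smaller dimension than
the domain. -/
theorem trdeg_range_lt {ι κ : Type} [Finite ι] (Φ : MvPolynomial ι ℂ →ₐ[ℂ] MvPolynomial κ ℂ)
    {f : MvPolynomial ι ℂ} (hf : f ≠ 0) (h : Φ f = 0) :
    Algebra.trdeg ℂ Φ.range < Cardinal.mk ι := by
  by_contra hle
  rw [not_lt] at hle
  let x : ι → Φ.range := fun a => ⟨Φ (MvPolynomial.X a), _, rfl⟩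
  have hx : ∀ p, MvPolynomial.aeval x p = Φ.rangeRestrict p := fun p => by
    have : MvPolynomial.aeval x = Φ.rangeRestrict := MvPolynomial.algHom_ext fun a => by
      rw [MvPolynomial.aeval_X]; rfl
    rw [this]
  have halg : Algebra.IsAlgebraic (Algebra.adjoin ℂ (Set.range x)) Φ.range := by
    refine ⟨fun b => ?_⟩
    obtain ⟨p, rfl⟩ := Φ.rangeRestrict_surjective b
    have hmem : Φ.rangeRestrict p ∈ Algebra.adjoin ℂ (Set.range x) := by
      rw [Algebra.adjoin_range_eq_range_aeval]
      exact ⟨p, hx p⟩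
    exact isAlgebraic_algebraMap (⟨_, hmem⟩ : Algebra.adjoin ℂ (Set.range x))
  have : FaithfulSMul ℂ Φ.range :=
    (faithfulSMul_iff_algebraMap_injective _ _).2 (algebraMap ℂ Φ.range).injective
  have hind := (Algebra.IsAlgebraic.isTranscendenceBasis_of_le_trdeg_of_finite ℂ x hle).1
  refine hf (hind ?_)
  rw [hx, map_zero]
  exact Subtype.ext h

end Count

section Mixture

variable {n k : ℕ}

/-- The vector of moments of a mixture whose weights need not have sum one. -/
noncomputable def weightedMoments (w : Fin k → ℂ) (μ : Fin k → Fin n → ℂ)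
    (σ : Fin k → Fin n → Fin n → ℂ) : MomentIndex n 3 → ℂ :=
  ∑ l, w l • cumulantMoments (μ l) (σ l) (fun _ _ _ => 0)

theorem continuous_weightedMoments {w : ℂ → Fin k → ℂ} (hw : Continuous w)
    (μ : Fin k → Fin n → ℂ) (σ : Fin k → Fin n → Fin n → ℂ) :
    Continuous fun u => weightedMoments (w u) μ σ := by
  unfold weightedMoments
  fun_prop

/-- A polynomial that vanishes on the moments of all mixtures and their multiples vanishes for all
choices of weights, also for those with sum zero. -/
theorem eval_weightedMoments_eq_zero_iff (f : MvPolynomial (MomentIndex n 3) ℂ) :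
    (∀ (θ : MixtureParam n (k + 1)) (t : ℂ), MvPolynomial.eval (t • θ.moments 3) f = 0) ↔
      ∀ (w : Fin (k + 1) → ℂ) (μ : Fin (k + 1) → Fin n → ℂ) (σ : Fin (k + 1) → Fin n → Fin n → ℂ),
        (∀ l i j, σ l i j = σ l j i) → MvPolynomial.eval (weightedMoments w μ σ) f = 0 := by
  constructor
  · intro h w μ σ hσ
    have key : ∀ v : Fin (k + 1) → ℂ, ∑ l, v l ≠ 0 →
        MvPolynomial.eval (weightedMoments v μ σ) f = 0 := by
      intro v hv
      let θ : MixtureParam n (k + 1) :=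
        { weight := fun l => (∑ l, v l)⁻¹ * v l
          mean := μ
          cov := fun l => Matrix.of (σ l)
          sum_weight := by rw [← Finset.mul_sum, inv_mul_cancel₀ hv]
          cov_symm := fun l => Matrix.IsSymm.ext fun i j => hσ l j i }
      have := h θ (∑ l, v l)
      rw [moments_eq_sum, Finset.smul_sum] at this
      rw [← this, weightedMoments]
      congr 2
      refine Finset.sum_congr rfl fun l _ => ?_
      rw [smul_smul, ← mul_assoc, mul_inv_cancel₀ hv, one_mul]
      rfl
    have := eval_eq_zero_of_punctured_line f
      (c := fun u => weightedMoments (Function.update w 0 u) μ σ)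
      (continuous_weightedMoments (continuous_const.update 0 continuous_id) μ σ)
      (-∑ l : Fin k, w l.succ) (fun u hu => key _ ?_) (w 0)
    · simpa using this
    · rw [Fin.sum_univ_succ]
      simpa [add_eq_zero_iff_eq_neg] using hu
  · intro h θ t
    have := h (t • θ.weight) θ.mean (fun l i j => θ.cov l i j)
      (fun l i j => (θ.cov_symm l).apply j i)
    rw [← this, moments_eq_sum, weightedMoments, Finset.smul_sum]
    simp only [smul_smul, Pi.smul_apply, smul_eq_mul]

/-- Two Gaussians in a mixture may be replaced by two others that have equal weights. -/
theorem exists_pair_equal_weights {w₀ w₁ : ℂ} (hw : w₀ + w₁ ≠ 0) (μ ν : Fin n → ℂ)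
    {σ τ : Fin n → Fin n → ℂ} (hσ : ∀ i j, σ i j = σ j i) (hτ : ∀ i j, τ i j = τ j i) :
    ∃ (μ' ν' : Fin n → ℂ) (σ' τ' : Fin n → Fin n → ℂ), (∀ i j, σ' i j = σ' j i) ∧
      (∀ i j, τ' i j = τ' j i) ∧
      w₀ • cumulantMoments μ σ (fun _ _ _ => 0) + w₁ • cumulantMoments ν τ (fun _ _ _ => 0) =
        ((w₀ + w₁) / 2) • cumulantMoments μ' σ' (fun _ _ _ => 0) +
          ((w₀ + w₁) / 2) • cumulantMoments ν' τ' (fun _ _ _ => 0) := by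
  set s := w₀ + w₁ with hs
  have e₀ : s * (w₀ / s) = w₀ := by field_simp
  have e₁ : s * (1 - w₀ / s) = w₁ := by rw [mul_sub, e₀, hs]; ring
  have h₁ := mixture_two_eq_cumulantMoments (w₀ / s) μ ν hσ hτ
  obtain ⟨σ', τ', hσ', hτ', h₂⟩ := cumulantMoments_eq_mixture_two (w := 1 / 2) (by norm_num)
    (by norm_num) (fun i => w₀ / s * μ i + (1 - w₀ / s) * ν i)
    (C := fun i j => w₀ / s * σ i j + (1 - w₀ / s) * τ i j +
      w₀ / s * (1 - w₀ / s) * (μ i - ν i) * (μ j - ν j))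
    (fun i j => by simp only [hσ i j, hτ i j]; ring)
    (fun i => μ i - ν i)
    (Q := fun i j => w₀ / s * (1 - w₀ / s) * (σ i j - τ i j +
      (1 - 2 * (w₀ / s)) / 3 * ((μ i - ν i) * (μ j - ν j))))
    (fun i j => by simp only [hσ i j, hτ i j]; ring)
  have h₃ := congrArg (s • ·) (h₁.trans h₂)
  simp only [smul_add, smul_smul, e₀, e₁, show s * (1 - 1 / 2) = s / 2 by ring,
    show s * (1 / 2) = s / 2 by ring] at h₃
  exact ⟨_, _, σ', τ', hσ', hτ', h₃⟩

theorem exists_equal_weights (w : Fin (k + 2) → ℂ) (hw : w 0 + w 1 ≠ 0)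
    (μ : Fin (k + 2) → Fin n → ℂ) {σ : Fin (k + 2) → Fin n → Fin n → ℂ}
    (hσ : ∀ l i j, σ l i j = σ l j i) :
    ∃ (v : Fin (k + 1) → ℂ) (μ' : Fin (k + 2) → Fin n → ℂ) (σ' : Fin (k + 2) → Fin n → Fin n → ℂ),
      (∀ l i j, σ' l i j = σ' l j i) ∧
        weightedMoments w μ σ =
          weightedMoments (Fin.cons (v 0) v : Fin (k + 2) → ℂ) μ' σ' := by
  obtain ⟨μ', ν', σ', τ', hσ', hτ', h⟩ := exists_pair_equal_weights hw (μ 0) (μ 1) (hσ 0) (hσ 1)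
  refine ⟨Fin.cons ((w 0 + w 1) / 2) fun l => w l.succ.succ,
    Fin.cons μ' (Fin.cons ν' fun l => μ l.succ.succ),
    Fin.cons σ' (Fin.cons τ' fun l => σ l.succ.succ), fun l => ?_, ?_⟩
  · refine Fin.cases hσ' (fun l => ?_) l
    refine Fin.cases hτ' (fun l => ?_) l
    exact hσ _
  · simp only [weightedMoments, Fin.sum_univ_succ, ← add_assoc]
    simp only [Fin.cons_zero, Fin.cons_succ]
    exact congrArg (· + _) h

theorem eval_weightedMoments_eq_zero_of_equal_weights {f : MvPolynomial (MomentIndex n 3) ℂ}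
    (h : ∀ (v : Fin (k + 1) → ℂ) (μ : Fin (k + 2) → Fin n → ℂ)
      (σ : Fin (k + 2) → Fin n → Fin n → ℂ), (∀ l i j, σ l i j = σ l j i) →
      MvPolynomial.eval (weightedMoments (Fin.cons (v 0) v : Fin (k + 2) → ℂ) μ σ) f = 0)
    (w : Fin (k + 2) → ℂ) (μ : Fin (k + 2) → Fin n → ℂ) (σ : Fin (k + 2) → Fin n → Fin n → ℂ)
    (hσ : ∀ l i j, σ l i j = σ l j i) : MvPolynomial.eval (weightedMoments w μ σ) f = 0 := by
  have := eval_eq_zero_of_punctured_line f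
    (c := fun u => weightedMoments (Function.update w 0 u) μ σ)
    (continuous_weightedMoments (continuous_const.update 0 continuous_id) μ σ)
    (-w 1) (fun u hu => ?_) (w 0)
  · simpa using this
  · obtain ⟨v, μ', σ', hσ', e⟩ := exists_equal_weights (Function.update w 0 u)
      (by simpa [add_eq_zero_iff_eq_neg] using hu) μ hσ
    rw [e]
    exact h v μ' σ' hσ'

/-- The variables of a parametrization of the cone over the secant variety by mixtures of `k + 2`
Gaussians, the first two of which have equal weights: weights, means and covariances. -/
abbrev EqualWeightVar (n k : ℕ) : Type :=
  Fin (k + 1) ⊕ Fin (k + 2) × (Fin n ⊕ Sym2 (Fin n))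

namespace EqualWeightVar

open MvPolynomial

theorem card_eq (n k : ℕ) :
    Fintype.card (EqualWeightVar n k) = (k + 2) * (n * (n + 3) / 2) + (k + 2) - 1 := by
  have h2 : n * (n + 3) / 2 = n + (n + 1).choose 2 := by
    rw [Nat.choose_two_right]
    have : n * (n + 3) = (n + 1) * (n + 1 - 1) + n * 2 := by
      simp only [Nat.add_sub_cancel]; ring
    rw [this, Nat.add_mul_div_right _ _ two_pos, add_comm]
  simp only [Fintype.card_sum, Fintype.card_prod, Sym2.card, Fintype.card_fin, h2]
  omega

/-- The homomorphism of coordinate rings that belongs to the parametrization. -/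
noncomputable def param (n k : ℕ) :
    MvPolynomial (MomentIndex n 3) ℂ →ₐ[ℂ] MvPolynomial (EqualWeightVar n k) ℂ :=
  aeval fun a => ∑ l, X (Sum.inl ((Fin.cons 0 id : Fin (k + 2) → Fin (k + 1)) l)) *
    cumulantMoments (fun i => X (Sum.inr (l, Sum.inl i)))
      (fun i j => X (Sum.inr (l, Sum.inr s(i, j)))) (fun _ _ _ => 0) a

theorem eval_param (v : EqualWeightVar n k → ℂ) (f : MvPolynomial (MomentIndex n 3) ℂ) :
    eval v (param n k f) = eval (weightedMoments
      (Fin.cons (v (Sum.inl 0)) fun l => v (Sum.inl l) : Fin (k + 2) → ℂ)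
      (fun l i => v (Sum.inr (l, Sum.inl i)))
      (fun l i j => v (Sum.inr (l, Sum.inr s(i, j))))) f := by
  have : (aeval v).comp (param n k) = aeval (weightedMoments
      (Fin.cons (v (Sum.inl 0)) fun l => v (Sum.inl l) : Fin (k + 2) → ℂ)
      (fun l i => v (Sum.inr (l, Sum.inl i)))
      (fun l i j => v (Sum.inr (l, Sum.inr s(i, j))))) := by
    refine MvPolynomial.algHom_ext fun a => ?_
    simp only [AlgHom.comp_apply, param, aeval_X, map_sum, map_mul, weightedMoments,
      Finset.sum_apply, Pi.smul_apply, smul_eq_mul]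
    refine Finset.sum_congr rfl fun l _ => ?_
    congr 1
    · refine Fin.cases ?_ (fun l => ?_) l <;> simp
    · have h := map_cumulantMoments (n := n) (c₁ := fun i => X (Sum.inr (l, Sum.inl i)))
        (c₂ := fun i j => X (Sum.inr (l, Sum.inr s(i, j)))) (c₃ := fun _ _ _ => 0)
        (aeval v : MvPolynomial (EqualWeightVar n k) ℂ →ₐ[ℂ] ℂ).toRingHom a
      simpa using h
  rw [← aeval_eq_eval, ← aeval_eq_eval, ← this]
  rfl

theorem param_eq_zero_iff (f : MvPolynomial (MomentIndex n 3) ℂ) :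
    param n k f = 0 ↔
      ∀ (θ : MixtureParam n (k + 2)) (t : ℂ), eval (t • θ.moments 3) f = 0 := by
  rw [eval_weightedMoments_eq_zero_iff]
  constructor
  · intro hf
    refine eval_weightedMoments_eq_zero_of_equal_weights fun v μ σ hσ => ?_
    have := eval_param (n := n) (k := k) (Sum.elim v fun p =>
      Sum.elim (μ p.1) (Sym2.lift ⟨σ p.1, hσ p.1⟩) p.2) f
    rw [hf, map_zero] at this
    exact this.symm
  · intro h
    refine MvPolynomial.funext fun v => ?_
    rw [eval_param, map_zero]
    exact h _ _ _ fun l i j => by rw [Sym2.eq_swap]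

/-- The homogeneous coordinate ring of the secant variety as a subalgebra of a polynomial ring. -/
noncomputable def coordinateRingEquiv (n k : ℕ) :
    HomogeneousCoordinateRing (gaussianSecant n 3 (k + 2)) ≃ₐ[ℂ] (param n k).range :=
  (Ideal.quotientEquivAlgOfEq ℂ (by
    ext f
    rw [mem_span_vanishingForms_iff, RingHom.mem_ker, param_eq_zero_iff])).trans
    (Ideal.quotientKerEquivRange (param n k))

end EqualWeightVar

theorem isDefective_of_ne_univ (hn : 1 ≤ n) (h : gaussianSecant n 3 (k + 2) ≠ Set.univ) :
    IsDefective n 3 (k + 2) := by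
  obtain ⟨p, hp⟩ := (Set.ne_univ_iff_exists_notMem _).1 h
  have : ∃ f ∈ vanishingForms (gaussianSecant n 3 (k + 2)), f ≠ 0 := by
    by_contra! hall
    refine hp fun f hf => ?_
    rw [gaussianSecant, vanishingForms_projClosure] at hall
    rw [hall f hf, map_zero]
  obtain ⟨f, hf, hf0⟩ := this
  have hΦ : EqualWeightVar.param n k f = 0 :=
    (EqualWeightVar.param_eq_zero_iff f).2
      (mem_span_vanishingForms_iff.1 (Ideal.subset_span hf))
  have h₁ : Cardinal.toNat (Algebra.trdeg ℂ (EqualWeightVar.param n k).range) <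
      Nat.card (MomentIndex n 3) :=
    Cardinal.toNat_lt_toNat (trdeg_range_lt _ hf0 hΦ) (Cardinal.mk_lt_aleph0)
  have h₂ : Cardinal.toNat (Algebra.trdeg ℂ (EqualWeightVar.param n k).range) ≤
      (k + 2) * (n * (n + 3) / 2) + (k + 2) - 1 := by
    have := trdeg_le_of_injective (EqualWeightVar.param n k).range.val
      Subtype.val_injective
    rw [MvPolynomial.trdeg_of_isDomain, Cardinal.mk_fintype, EqualWeightVar.card_eq,
      Cardinal.lift_natCast] at this
    exact (Cardinal.toNat_le_toNat this Cardinal.natCast_lt_aleph0).trans_eq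
      (Cardinal.toNat_natCast _)
  have h₃ := card_momentIndex_le n 3
  have h₄ : 4 ≤ (n + 3).choose 3 := by
    have := Nat.choose_le_choose 3 (show 4 ≤ n + 3 by omega)
    simpa using this
  rw [IsDefective, projDim, (EqualWeightVar.coordinateRingEquiv n k).trdeg_eq, expectedDim,
    ambientDim, lt_min_iff]
  omega

end Mixture

/-! ### Identifiability of mixtures of two Gaussians -/

section Identifiability

open MvPolynomial

variable {n : ℕ}

/-- The form whose zeros are excluded: where it does not vanish, the third cumulant is nonzero at
`(x, x, x)` and has at most one linear factor. -/
noncomputable def genericityForm (x y z : Fin n) : MvPolynomial (MomentIndex n 3) ℂ :=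
  cumulantForm x x x * hessianMinor cumulantForm x y z

theorem isHomogeneous_genericityForm (x y z : Fin n) : (genericityForm x y z).IsHomogeneous 15 := by
  have hK : ∀ i j k : Fin n, (cumulantForm i j k).IsHomogeneous 3 := isHomogeneous_cumulantForm
  have hS : ∀ p q r : Fin n, (sliceDet cumulantForm x y z p q r).IsHomogeneous 9 := fun p q r =>
    (((hK _ _ _).mul (((hK _ _ _).mul (hK _ _ _)).sub ((hK _ _ _).mul (hK _ _ _)))).sub
      ((hK _ _ _).mul (((hK _ _ _).mul (hK _ _ _)).sub ((hK _ _ _).mul (hK _ _ _))))).add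
      ((hK _ _ _).mul (((hK _ _ _).mul (hK _ _ _)).sub ((hK _ _ _).mul (hK _ _ _))))
  have h3 : (3 : MvPolynomial (MomentIndex n 3) ℂ).IsHomogeneous 0 := by
    rw [show (3 : MvPolynomial (MomentIndex n 3) ℂ) = C 3 from rfl]
    exact isHomogeneous_C _ 3
  exact (hK _ _ _).mul (((hK _ _ _).mul (((hS _ _ _).add (hS _ _ _)).add (hS _ _ _))).sub
    ((h3.mul (hK _ _ _)).mul (hS _ _ _)))

theorem eval_genericityForm (c : Fin n → ℂ) {C : Fin n → Fin n → ℂ}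
    {K : Fin n → Fin n → Fin n → ℂ} (hC : ∀ i j, C i j = C j i) (hK : IsSymmTensor K)
    (x y z : Fin n) :
    eval (cumulantMoments c C K) (genericityForm x y z) = K x x x * hessianMinor K x y z := by
  have h : ∀ i j k, eval (cumulantMoments c C K) (cumulantForm i j k) = K i j k := fun i j k => by
    have := aeval_cumulantForm 1 c hC hK i j k
    simpa [aeval_eq_eval] using this
  simp only [genericityForm, hessianMinor, sliceDet, map_mul, map_add, map_sub, map_ofNat, h]

theorem param_genericityForm_ne_zero {x y z : Fin n} (hx : x.val = 0) (hy : y.val = 1)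
    (hz : z.val = 2) : CubicVar.param x (genericityForm x y z) ≠ 0 := by
  intro h0
  -- the cubic form `x * q`, where `q = x ^ 2 + 2 * x * y + 2 * y * z` up to further variables
  let L : Fin n → ℂ := fun i => if i = x then 1 else 0
  let Q : Fin n → Fin n → ℂ := fun i j =>
    if i.val + j.val = 0 ∨ i.val + j.val = 1 ∨ i.val + j.val = 3 then 1 else 0
  have hQ : ∀ i j, Q i j = Q j i := fun i j => by simp only [Q, add_comm]
  have hyx : y ≠ x := fun h => by rw [h] at hy; omega
  have h := CubicVar.eval_param (x := x) (genericityForm x y z) (s := 1) (m := 0)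
    (C := fun _ _ => 0) (L := L) (fun _ _ => rfl) hQ (by simp [L])
  rw [h0, map_zero, one_smul,
    eval_genericityForm _ (fun _ _ => rfl) (isSymmTensor_symProd hQ),
    hessianMinor_symProd L hQ] at h
  norm_num [symProd, subDet, L, Q, hx, hy, hz, hyx] at h

/-- The complement of the zero locus of `genericityForm` is dense in the secant variety. -/
theorem gaussianSecant_subset_projClosure_diff {x y z : Fin n} (hx : x.val = 0) (hy : y.val = 1)
    (hz : z.val = 2) :
    gaussianSecant n 3 2 ⊆ projClosure (gaussianSecant n 3 2 \
      {p | eval p.rep (genericityForm x y z) = 0}) := by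
  intro p hp g hg
  obtain ⟨⟨e, he⟩, hg⟩ := hg
  have hF := isHomogeneous_genericityForm x y z
  have hgF : CubicVar.param x (g * genericityForm x y z) = 0 := by
    rw [CubicVar.param_eq_zero_iff]
    intro θ t
    rw [eval_smul_of_isHomogeneous (he.mul hF), map_mul]
    by_cases h : eval (θ.point 3).rep (genericityForm x y z) = 0
    · rw [(eval_rep_eq_zero_iff hF (θ.moments_ne_zero 3)).1 h]; simp
    · have := hg (θ.point 3) ⟨subset_projClosure _ ⟨θ, rfl⟩, h⟩
      rw [(eval_rep_eq_zero_iff he (θ.moments_ne_zero 3)).1 this]; simp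
  rw [map_mul, mul_eq_zero, or_iff_left (param_genericityForm_ne_zero hx hy hz),
    CubicVar.param_eq_zero_iff] at hgF
  have hgS : g ∈ vanishingForms (gaussianSecant n 3 2) :=
    mem_vanishingForms_gaussianSecant.2 ⟨⟨e, he⟩, fun θ => by simpa using hgF θ 1⟩
  exact hgS.2 p hp

/-- Two mixtures with the same generic moments and the same first coordinates of the means agree:
the first moment gives the weights, and the linear factor and its cofactor give the rest. -/
theorem mixtureParam_two_unique {m : MomentIndex n 3 → ℂ} {x y z : Fin n}
    (hF : eval m (genericityForm x y z) ≠ 0) {a b : ℂ} (hab : a ≠ b) {θ θ' : MixtureParam n 2}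
    (hθ : θ.moments 3 = m) (hθ' : θ'.moments 3 = m) (ha : θ.mean 0 x = a) (hb : θ.mean 1 x = b)
    (ha' : θ'.mean 0 x = a) (hb' : θ'.mean 1 x = b) : θ = θ' := by
  obtain ⟨w, σ, τ, hw₀, hw₁, hσθ, hτθ, hσ, hτ, h⟩ := moments_two θ
  obtain ⟨w', σ', τ', hw₀', hw₁', hσθ', hτθ', hσ', hτ', h'⟩ := moments_two θ'
  rw [mixture_two_eq_cumulantMoments w _ _ hσ hτ, hθ] at h
  rw [mixture_two_eq_cumulantMoments w' _ _ hσ' hτ', hθ'] at h'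
  have hC : ∀ i j, w * σ i j + (1 - w) * τ i j +
      w * (1 - w) * (θ.mean 0 i - θ.mean 1 i) * (θ.mean 0 j - θ.mean 1 j) =
      w * σ j i + (1 - w) * τ j i +
      w * (1 - w) * (θ.mean 0 j - θ.mean 1 j) * (θ.mean 0 i - θ.mean 1 i) := fun i j => by
    rw [hσ i j, hτ i j]; ring
  have hC' : ∀ i j, w' * σ' i j + (1 - w') * τ' i j +
      w' * (1 - w') * (θ'.mean 0 i - θ'.mean 1 i) * (θ'.mean 0 j - θ'.mean 1 j) =
      w' * σ' j i + (1 - w') * τ' j i +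
      w' * (1 - w') * (θ'.mean 0 j - θ'.mean 1 j) * (θ'.mean 0 i - θ'.mean 1 i) := fun i j => by
    rw [hσ' i j, hτ' i j]; ring
  have hQ : ∀ i j, w * (1 - w) * (σ i j - τ i j + (1 - 2 * w) / 3 *
        ((θ.mean 0 i - θ.mean 1 i) * (θ.mean 0 j - θ.mean 1 j))) =
      w * (1 - w) * (σ j i - τ j i + (1 - 2 * w) / 3 *
        ((θ.mean 0 j - θ.mean 1 j) * (θ.mean 0 i - θ.mean 1 i))) := fun i j => by
    rw [hσ i j, hτ i j]; ring
  have hQ' : ∀ i j, w' * (1 - w') * (σ' i j - τ' i j + (1 - 2 * w') / 3 *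
        ((θ'.mean 0 i - θ'.mean 1 i) * (θ'.mean 0 j - θ'.mean 1 j))) =
      w' * (1 - w') * (σ' j i - τ' j i + (1 - 2 * w') / 3 *
        ((θ'.mean 0 j - θ'.mean 1 j) * (θ'.mean 0 i - θ'.mean 1 i))) := fun i j => by
    rw [hσ' i j, hτ' i j]; ring
  obtain ⟨e₁, e₂, e₃⟩ := cumulantMoments_injective hC hC' (isSymmTensor_symProd hQ)
    (isSymmTensor_symProd hQ') (h.symm.trans h')
  rw [h, eval_genericityForm _ hC (isSymmTensor_symProd hQ)] at hF
  have hab' : a - b ≠ 0 := sub_ne_zero.2 hab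
  -- the first moment determines the weights
  have hww : w = w' := by
    have := congrFun e₁ x
    simp only [ha, hb, ha', hb'] at this
    refine mul_right_cancel₀ hab' ?_
    linear_combination this
  subst hww
  -- the third cumulant determines the difference of the means and that of the covariances
  have hδ := linearFactor_unique hQ hQ' e₃ x y z (by rw [ha, hb, ha', hb'])
    (right_ne_zero_of_mul hF)
  have hδ' : ∀ i, θ.mean 0 i - θ.mean 1 i = θ'.mean 0 i - θ'.mean 1 i := fun i => congrFun hδ i
  simp only [hδ'] at e₃ e₂
  have hQQ := cofactor_unique e₃ (x := x) (by rw [ha', hb']; exact hab')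
  have hw : w * (1 - w) ≠ 0 := fun h0 => by
    apply left_ne_zero_of_mul hF
    simp only [symProd, h0]
    ring
  have hm : ∀ i, θ.mean 0 i = θ'.mean 0 i ∧ θ.mean 1 i = θ'.mean 1 i := fun i => by
    have h₁ : w * θ.mean 0 i + (1 - w) * θ.mean 1 i = w * θ'.mean 0 i + (1 - w) * θ'.mean 1 i :=
      congrFun e₁ i
    exact ⟨by linear_combination h₁ + (1 - w) * hδ' i, by linear_combination h₁ - w * hδ' i⟩
  have hc : ∀ i j, σ i j = σ' i j ∧ τ i j = τ' i j := fun i j => by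
    have h₁ := congrFun (congrFun e₂ i) j
    have h₂ := mul_left_cancel₀ hw (congrFun (congrFun hQQ i) j)
    beta_reduce at h₁ h₂
    exact ⟨by linear_combination h₁ + (1 - w) * h₂, by linear_combination h₁ - w * h₂⟩
  have hσσ : σ = σ' := funext fun i => funext fun j => (hc i j).1
  have hττ : τ = τ' := funext fun i => funext fun j => (hc i j).2
  refine MixtureParam.ext ?_ ?_ ?_ <;> funext l <;> fin_cases l
  · exact hw₀.symm.trans hw₀'
  · exact hw₁.trans hw₁'.symm
  · exact funext fun i => (hm i).1
  · exact funext fun i => (hm i).2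
  · exact hσθ.trans (hσσ ▸ hσθ'.symm)
  · exact hτθ.trans (hττ ▸ hτθ'.symm)

/-- The linear factor of the third cumulant can be scaled to have the prescribed value `a - b` at
`x`. -/
theorem exists_mixtureParam_two {m : MomentIndex n 3 → ℂ} {hm : m ≠ 0}
    (h : Projectivization.mk ℂ m hm ∈ gaussianSecant n 3 2) (h₀ : m (MomentIndex.zero n 3) = 1)
    {x : Fin n} (hκ : eval m (cumulantForm x x x) ≠ 0) {a b : ℂ} (hab : a ≠ b)
    (ha : a ≠ m (MomentIndex.one x)) (hb : b ≠ m (MomentIndex.one x)) :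
    ∃ θ : MixtureParam n 2, θ.moments 3 = m ∧ θ.mean 0 x = a ∧ θ.mean 1 x = b := by
  obtain ⟨c, L, C, Q, hC, hQ, hL, rfl⟩ := CubicVar.exists_eq_cumulantMoments h h₀ hκ
  rw [cumulantMoments_one] at ha hb
  have hab' : a - b ≠ 0 := sub_ne_zero.2 hab
  -- the weight for which the first moment is the average of `a` and `b`
  set w := (c x - b) / (a - b) with hw
  have hw₀ : w ≠ 0 := div_ne_zero (sub_ne_zero.2 hb.symm) hab'
  have hw₁ : 1 - w = (a - c x) / (a - b) := by rw [hw]; field_simp; ring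
  obtain ⟨σ, τ, hσ, hτ, e⟩ := cumulantMoments_eq_mixture_two hw₀
    (hw₁ ▸ div_ne_zero (sub_ne_zero.2 ha) hab') c hC (fun i => (a - b) * L i)
    (Q := fun i j => Q i j / (a - b)) (fun i j => by rw [hQ])
  refine ⟨mixtureTwo w (fun i => c i + (1 - w) * ((a - b) * L i))
    (fun i => c i - w * ((a - b) * L i))
    σ τ hσ hτ, ?_, ?_, ?_⟩
  · rw [moments_mixtureTwo, ← e]
    congr 1
    funext i j k
    simp only [symProd]
    field_simp
  · change c x + (1 - w) * ((a - b) * L x) = a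
    rw [hw₁, hL]; field_simp; ring
  · change c x - w * ((a - b) * L x) = b
    rw [hw, hL]; field_simp; ring

end Identifiability

theorem theorem3p2 (n : ℕ) (hn : 1 ≤ n) :
    -- `k`-defectivity for all `k ≥ 2` for which the secant variety does not fill the ambient space
    (∀ k : ℕ, 2 ≤ k → gaussianSecant n 3 k ≠ Set.univ → IsDefective n 3 k) ∧
    -- for `k = 2`, two more parameters than the dimension of the secant variety
    ((n * (n + 3) + 1 : ℤ) - (projDim (gaussianSecant n 3 2) : ℤ) = 2) ∧
    -- for `n ≥ 3` and a general point of the secant variety, with affine coordinates `m`: once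
    -- distinct first coordinates `a`, `b` of the two means are fixed, at most one choice of all
    -- parameters has the moments `m`, and there is one unless `a` or `b` is the first moment of `m`
    (∀ hn3 : 3 ≤ n, ∃ Z : Set (ℙ ℂ (MomentIndex n 3 → ℂ)),
      projClosure Z = Z ∧
      gaussianSecant n 3 2 ⊆ projClosure (gaussianSecant n 3 2 \ Z) ∧
      ∀ (m : MomentIndex n 3 → ℂ) (hm : m ≠ 0), m (MomentIndex.zero n 3) = 1 →
        Projectivization.mk ℂ m hm ∈ gaussianSecant n 3 2 \ Z →
        ∀ a b : ℂ, a ≠ b →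
          {θ : MixtureParam n 2 | θ.moments 3 = m ∧
            θ.mean 0 ⟨0, by omega⟩ = a ∧ θ.mean 1 ⟨0, by omega⟩ = b}.Subsingleton ∧
          (a ≠ m ⟨Finsupp.single ⟨0, by omega⟩ 1, by simp⟩ →
            b ≠ m ⟨Finsupp.single ⟨0, by omega⟩ 1, by simp⟩ →
            {θ : MixtureParam n 2 | θ.moments 3 = m ∧
              θ.mean 0 ⟨0, by omega⟩ = a ∧ θ.mean 1 ⟨0, by omega⟩ = b}.Nonempty)) := by
  refine ⟨fun k hk h => ?_, ?_, fun hn3 => ?_⟩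
  · obtain ⟨k, rfl⟩ := Nat.exists_eq_add_of_le' hk
    exact isDefective_of_ne_univ hn h
  · rw [CubicVar.projDim_gaussianSecant_two hn]
    have : 1 ≤ n * (n + 3) := Nat.mul_pos hn (by omega)
    push_cast [Nat.cast_sub this]
    ring
  · let x : Fin n := ⟨0, by omega⟩
    let y : Fin n := ⟨1, by omega⟩
    let z : Fin n := ⟨2, by omega⟩
    have hF := isHomogeneous_genericityForm x y z
    refine ⟨{p | MvPolynomial.eval p.rep (genericityForm x y z) = 0}, projClosure_zeroLocus hF,
      gaussianSecant_subset_projClosure_diff rfl rfl rfl, fun m hm h₀ hmem a b hab => ?_⟩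
    have hFm : MvPolynomial.eval m (genericityForm x y z) ≠ 0 := fun h =>
      hmem.2 ((eval_rep_eq_zero_iff hF hm).2 h)
    refine ⟨fun θ hθ θ' hθ' => mixtureParam_two_unique hFm hab hθ.1 hθ'.1 hθ.2.1 hθ.2.2
      hθ'.2.1 hθ'.2.2, fun ha hb => ?_⟩
    have hκ : MvPolynomial.eval m (cumulantForm x x x) ≠ 0 := by
      rw [genericityForm, map_mul] at hFm
      exact left_ne_zero_of_mul hFm
    exact exists_mixtureParam_two hmem.1 h₀ hκ hab ha hb
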